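/- Let $\phi=\alpha_1\wedge\dots\wedge\alpha_k$ be a monotone 3-CNF formula over variables $x_1,\dots,x_n$, with clauses $\alpha_i=(x_{r_{i,1}}\vee x_{r_{i,2}}\vee x_{r_{i,3}})$, $1\le r_{i,1}<r_{i,2}<r_{i,3}\le n$. It is NAE-satisfiable if some truth assignment gives every clause at least one true and at least one false variable. A graph is a bounded tolerance graph if there are closed real intervals $I_v$ and numbers $0<t_v\le |I_v|$ for its vertices $v$ such that distinct $u,v$ are adjacent if and only if $|I_u\cap I_v|\ge\min\{t_u,t_v\}$. A trapezoid graph is the intersection graph of trapezoids between two parallel lines $L_1$ (top) and $L_2$ (bottom), each with a left and a right line joining $L_1$ to $L_2$. Construction of $H_\phi$. Order the $3k$ literals $(i,j)$ of $\phi$ from left to right so that the literals of $x_p$ precede those of $x_q$ whenever $p<q$; the order among literals of the same variable is arbitrary. Represent the literal $(i,j)$ by two crossing lines $\ell^1_{i,j},\ell^2_{i,j}$ between $L_1$ and $L_2$, where $\ell^1_{i,j}$ has the larger angle with $L_2$ (its endpoint is the left one on $L_1$ and the right one on $L_2$), the pairs of lines of different literals being disjoint and placed from left to right in the chosen order. For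 any two consecutive literals $(i,j),(i',j')$ of the same variable add two parallel lines $u$ (left) and $v$ (right) that cross $\ell^1_{i,j}$ and $\ell^1_{i',j'}$ and no other line. All endpoints are distinct. Write $(a_i,c_i)$, $(e_i,b_i)$, $(d_i,f_i)$ for $(\ell^1_{i,j},\ell^2_{i,j})$ with $j=1,2,3$, and group the lines into the ordered pairs $(a_i,b_i)$, $(c_i,d_i)$, $(e_i,f_i)$ for all $i$, and $(u,v)$ for all added lines. If every variable occurs in $\phi$ there are $m=6k-n$ pairs; in general $n$ is replaced here by the number of variables that occur. Each pair $(u^1,u^2)$ contributes seven trapezoids: the one with left line $u^1$ and right line $u^2$; three parallelograms whose left and right lines are $u^1$ shifted horizontally by $-\frac{\varepsilon}{2},\frac{\varepsilon}{2}$, by $-\frac{3\varepsilon}{4},-\frac{\varepsilon}{4}$, and by $-\frac{7\varepsilon}{8},-\frac{3\varepsilon}{8}$; and three whose left and right lines are $u^2$ shifted by $-\frac{\varepsilon}{2},\frac{\varepsilon}{2}$, by $\frac{\varepsilon}{4},\frac{3\varepsilon}{4}$, and by $\frac{3\varepsilon}{8},\frac{7\varepsilon}{8}$. Here $\varepsilon>0$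 is so small that between the endpoints of the three parallelograms at a line there are no endpoints other than those of that line and of these parallelograms. Let $H_\phi$ be the intersection graph of all these trapezoids. Theorem. $H_\phi$ is a trapezoid graph with $7m$ vertices, and $\phi$ is NAE-satisfiable if and only if $H_\phi$ is a bounded tolerance graph. -/

import Mathlib

/-! ### Intersection models between two parallel lines

`L₁` is the line `y = 1` (top) and `L₂` is the line `y = 0` (bottom). -/

/-- A line segment with one endpoint on `L₁` and one on `L₂`, given by their abscissae. -/
structure Seg where
  top : ℝ
  bot : ℝ

/-- The segment moved horizontally by `d` (a parallel segment). -/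
def Seg.shift (s : Seg) (d : ℝ) : Seg := ⟨s.top + d, s.bot + d⟩

/-- The abscissa of the point of the segment at height `y`. -/
def Seg.at (s : Seg) (y : ℝ) : ℝ := (1 - y) * s.bot + y * s.top

/-- A (possibly degenerate) trapezoid between `L₁` and `L₂` with a left and a right line. -/
structure Trapezoid where
  left : Seg
  right : Seg
  top_le : left.top ≤ right.top
  bot_le : left.bot ≤ right.bot

/-- The closed region of the plane that the trapezoid occupies. -/
def Trapezoid.region (T : Trapezoid) : Set (ℝ × ℝ) :=
  {p | 0 ≤ p.2 ∧ p.2 ≤ 1 ∧ T.left.at p.2 ≤ p.1 ∧ p.1 ≤ T.right.at p.2}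

/-- The parallelogram whose left and right lines are `s` moved by `d` and by `d'`. -/
def Seg.band (s : Seg) (d d' : ℝ) (h : d ≤ d') : Trapezoid where
  left := s.shift d
  right := s.shift d'
  top_le := by simpa [Seg.shift] using h
  bot_le := by simpa [Seg.shift] using h

/-- The intersection graph of a family of trapezoids. -/
def trapezoidGraph {V : Type*} (R : V → Trapezoid) : SimpleGraph V where
  Adj u v := u ≠ v ∧ ((R u).region ∩ (R v).region).Nonempty
  symm := ⟨fun _ _ h => ⟨h.1.symm, by rw [Set.inter_comm]; exact h.2⟩⟩
  loopless := ⟨fun _ h => h.1 rfl⟩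

/-- `G` is a trapezoid graph: it is the intersection graph of trapezoids between two lines. -/
def IsTrapezoidGraph {V : Type*} (G : SimpleGraph V) : Prop :=
  ∃ R : V → Trapezoid, G = trapezoidGraph R

/-! ### Bounded tolerance graphs -/

/-- The intervals `[l v, r v]` and the positive tolerances `t v` represent `G`. -/
structure IsToleranceRepresentation {V : Type*} (G : SimpleGraph V) (l r t : V → ℝ) : Prop where
  le : ∀ v, l v ≤ r v
  pos : ∀ v, 0 < t v
  adj_iff : ∀ u v, u ≠ v →
    (G.Adj u v ↔
      min (t u) (t v) ≤ MeasureTheory.volume.real (Set.Icc (l u) (r u) ∩ Set.Icc (l v) (r v)))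

/-- `G` has a tolerance representation in which no tolerance exceeds the length of its interval. -/
def IsBoundedToleranceGraph {V : Type*} (G : SimpleGraph V) : Prop :=
  ∃ l r t : V → ℝ, IsToleranceRepresentation G l r t ∧
    ∀ v, t v ≤ MeasureTheory.volume.real (Set.Icc (l v) (r v))

/-! ### Monotone 3-CNF formulas -/

/-- A monotone 3-CNF formula with `k` clauses over `n` variables; clause `i` is the disjunction
of the three distinct variables `var i 0 < var i 1 < var i 2`. -/
structure Monotone3CNF (k n : ℕ) where
  var : Fin k → Fin 3 → Fin n
  strictMono : ∀ i, StrictMono (var i)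

namespace Monotone3CNF

variable {k n : ℕ}

/-- Some assignment gives every clause a true and a false variable. -/
def NAESatisfiable (φ : Monotone3CNF k n) : Prop :=
  ∃ τ : Fin n → Bool, ∀ i, (∃ j, τ (φ.var i j) = true) ∧ (∃ j, τ (φ.var i j) = false)

/-- A left-to-right order of the `3k` literals in which the literals of a variable of smaller
index precede those of a variable of larger index; the literals of one variable may come in any
order. -/
structure LiteralOrder (φ : Monotone3CNF k n) where
  pos : Fin k × Fin 3 ≃ Fin (3 * k)
  lt_of_var_lt : ∀ x y : Fin k × Fin 3, φ.var x.1 x.2 < φ.var y.1 y.2 → pos x < pos y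

namespace LiteralOrder

variable {φ : Monotone3CNF k n} (σ : LiteralOrder φ)

/-- Pairs of consecutive literals of one and the same variable. -/
def Link : Type :=
  {q : (Fin k × Fin 3) × (Fin k × Fin 3) //
    (σ.pos q.2 : ℕ) = (σ.pos q.1 : ℕ) + 1 ∧ φ.var q.1.1 q.1.2 = φ.var q.2.1 q.2.2}

/-! The permutation representation. The literal at position `p` owns the abscissae
`4p, …, 4p + 3` on both lines:
* on `L₁`, from left to right: `ℓ¹`, then `u` and `v` of the link ending at this literal, then `ℓ²`;
* on `L₂`, from left to right: `ℓ²`, then `u` and `v` of the link starting at this literal,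
  then `ℓ¹`.

So `ℓ¹` and `ℓ²` of a literal cross, with `ℓ¹` having the larger angle with `L₂`; the parallel
lines `u`, `v` of a link cross `ℓ¹` of both its literals; there are no other crossings. -/

/-- The line `ℓ¹` of a literal. -/
def line₁ (x : Fin k × Fin 3) : Seg := ⟨4 * (σ.pos x : ℕ), 4 * (σ.pos x : ℕ) + 3⟩

/-- The line `ℓ²` of a literal. -/
def line₂ (x : Fin k × Fin 3) : Seg := ⟨4 * (σ.pos x : ℕ) + 3, 4 * (σ.pos x : ℕ)⟩

/-- The line `u` of a link. -/
def lineU (q : σ.Link) : Seg := ⟨4 * (σ.pos q.1.2 : ℕ) + 1, 4 * (σ.pos q.1.1 : ℕ) + 1⟩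

/-- The line `v` of a link. -/
def lineV (q : σ.Link) : Seg := ⟨4 * (σ.pos q.1.2 : ℕ) + 2, 4 * (σ.pos q.1.1 : ℕ) + 2⟩

/-- The pairs into which the lines are grouped. With `(a, c)`, `(e, b)`, `(d, f)` the lines
`(ℓ¹, ℓ²)` of the first, second and third literal of clause `i`, the pairs of the clause are
`{a, b}`, `{c, d}`, `{e, f}`; the lines `u`, `v` of a link form a pair. -/
inductive LinePair : Type
  | ab (i : Fin k)
  | cd (i : Fin k)
  | ef (i : Fin k)
  | uv (q : σ.Link)

/-- The first (left) line of a pair. -/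
def leftLine : σ.LinePair → Seg
  | .ab i => σ.line₁ (i, 0)
  | .cd i => σ.line₂ (i, 0)
  | .ef i => σ.line₁ (i, 1)
  | .uv q => σ.lineU q

/-- The second (right) line of a pair. -/
def rightLine : σ.LinePair → Seg
  | .ab i => σ.line₂ (i, 1)
  | .cd i => σ.line₁ (i, 2)
  | .ef i => σ.line₂ (i, 2)
  | .uv q => σ.lineV q

theorem pos_add_one_le (i : Fin k) {j j' : Fin 3} (h : j < j') :
    ((σ.pos (i, j) : ℕ) : ℝ) + 1 ≤ ((σ.pos (i, j') : ℕ) : ℝ) := by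
  have h₁ : σ.pos (i, j) < σ.pos (i, j') := σ.lt_of_var_lt _ _ (φ.strictMono i h)
  exact_mod_cast Nat.succ_le_of_lt h₁

theorem left_le_right (w : σ.LinePair) :
    (σ.leftLine w).top ≤ (σ.rightLine w).top ∧ (σ.leftLine w).bot ≤ (σ.rightLine w).bot := by
  rcases w with i | i | i | q
  · have := σ.pos_add_one_le i (j := 0) (j' := 1) (by decide)
    constructor <;> simp only [leftLine, rightLine, line₁, line₂] <;> linarith
  · have := σ.pos_add_one_le i (j := 0) (j' := 2) (by decide)
    constructor <;> simp only [leftLine, rightLine, line₁, line₂] <;> linarith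
  · have := σ.pos_add_one_le i (j := 1) (j' := 2) (by decide)
    constructor <;> simp only [leftLine, rightLine, line₁, line₂] <;> linarith
  · constructor <;> simp only [leftLine, rightLine, lineU, lineV] <;> linarith

/-- The trapezoid spanned by the two lines of a pair. -/
def trapezoid (w : σ.LinePair) : Trapezoid where
  left := σ.leftLine w
  right := σ.rightLine w
  top_le := (σ.left_le_right w).1
  bot_le := (σ.left_le_right w).2

/-- The width used for the six added parallelograms. Distinct endpoints of the lines are at
distance at least `1` and the parallelograms stay within `7ε/8 < 1/2` of their line, so between
the endpoints of the parallelograms at a line there are no endpoints other than those of this line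
and of these parallelograms. Shrinking the width from pair to pair would give the same
left-to-right order of all endpoints, hence the same graph. -/
noncomputable def ε : ℝ := 1 / 2

theorem ε_pos : 0 < ε := by norm_num [ε]

/-- The trapezoid representation of the final graph: each pair contributes its trapezoid (index
`0`), three parallelograms at its left line and three at its right line. -/
noncomputable def repH : σ.LinePair × Fin 7 → Trapezoid
  | (w, 0) => σ.trapezoid w
  | (w, 1) => (σ.leftLine w).band (-(ε / 2)) (ε / 2) (by linarith [ε_pos])
  | (w, 2) => (σ.leftLine w).band (-(3 * ε / 4)) (-(ε / 4)) (by linarith [ε_pos])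
  | (w, 3) => (σ.leftLine w).band (-(7 * ε / 8)) (-(3 * ε / 8)) (by linarith [ε_pos])
  | (w, 4) => (σ.rightLine w).band (-(ε / 2)) (ε / 2) (by linarith [ε_pos])
  | (w, 5) => (σ.rightLine w).band (ε / 4) (3 * ε / 4) (by linarith [ε_pos])
  | (w, 6) => (σ.rightLine w).band (3 * ε / 8) (7 * ε / 8) (by linarith [ε_pos])

/-- The graph `H_φ`. -/
noncomputable def graphH : SimpleGraph (σ.LinePair × Fin 7) := trapezoidGraph σ.repH

end LiteralOrder

end Monotone3CNF

/-!
Shear a set of parallelograms until all their slopes are positive: one of slope `t` that spans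
`[l, r]` corresponds to the interval `[l, r]` with tolerance `t`. So the bounded tolerance graphs
are the intersection graphs of parallelograms.

In every representation of `H_φ` the trapezoids at a line leave a gap there, which borders on the
trapezoid of its pair. If all trapezoids are parallelograms, two crossing lines therefore force a
strict inequality between the slopes of their pairs, whose direction, for the two lines of a
literal, gives the literal a truth value. The parallelograms of a link are disjoint only if the
values at its two ends agree, so the values come from an assignment. A clause with three equal
values would order the slopes of its pairs `(a, b)`, `(c, d)`, `(e, f)` cyclically.

Conversely, lines of different variables do not cross, so the lines of the variables that are false
under an assignment may be turned upside down. If the values in each clause are not all equal, they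
order its three pairs without a cycle, and the lines can be tilted so that the two lines of a pair
are parallel, with slope proportional to the rank of the pair.
-/

/-! ### Separated trapezoids -/

namespace Seg

/-- `s` lies strictly to the left of `t`, on `L₁` and on `L₂`. -/
def LeftOf (s t : Seg) : Prop := s.top < t.top ∧ s.bot < t.bot

/-- The horizontal displacement of a segment from `L₂` to `L₁`; equal for parallel segments. -/
def slope (s : Seg) : ℝ := s.top - s.bot

theorem slope_shift (s : Seg) (d : ℝ) : (s.shift d).slope = s.slope :=
  add_sub_add_right_eq_sub _ _ _

theorem at_zero (s : Seg) : s.at 0 = s.bot := by simp [Seg.at]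

theorem at_one (s : Seg) : s.at 1 = s.top := by simp [Seg.at]

theorem continuous_at (s : Seg) : Continuous s.at := by
  unfold Seg.at
  fun_prop

theorem at_mono {s t : Seg} (htop : s.top ≤ t.top) (hbot : s.bot ≤ t.bot) {y : ℝ}
    (hy : y ∈ Set.Icc (0 : ℝ) 1) : s.at y ≤ t.at y :=
  add_le_add (mul_le_mul_of_nonneg_left hbot (sub_nonneg.2 hy.2))
    (mul_le_mul_of_nonneg_left htop hy.1)

theorem LeftOf.at_lt_at {s t : Seg} (h : s.LeftOf t) {y : ℝ} (hy : y ∈ Set.Icc (0 : ℝ) 1) :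
    s.at y < t.at y := by
  rcases hy.1.eq_or_lt with rfl | hy₀
  · simpa only [at_zero] using h.2
  · exact add_lt_add_of_le_of_lt (mul_le_mul_of_nonneg_left h.2.le (sub_nonneg.2 hy.2))
      (mul_lt_mul_of_pos_left h.1 hy₀)

end Seg

namespace Trapezoid

/-- `S` lies strictly to the left of `T`. -/
def LeftOf (S T : Trapezoid) : Prop := S.right.LeftOf T.left

/-- One of the two trapezoids lies strictly to the left of the other. -/
def Separated (S T : Trapezoid) : Prop := S.LeftOf T ∨ T.LeftOf S

theorem Separated.symm {S T : Trapezoid} (h : S.Separated T) : T.Separated S := Or.symm h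

theorem LeftOf.trans {S T U : Trapezoid} (h : S.LeftOf T) (h' : T.LeftOf U) : S.LeftOf U :=
  ⟨(h.1.trans_le T.top_le).trans h'.1, (h.2.trans_le T.bot_le).trans h'.2⟩

theorem not_separated_self (T : Trapezoid) : ¬ T.Separated T := by
  rintro (h | h) <;> exact T.top_le.not_gt h.1

theorem LeftOf.disjoint_region {S T : Trapezoid} (h : S.LeftOf T) :
    Disjoint S.region T.region :=
  Set.disjoint_left.2 fun _ ⟨hy₀, hy₁, _, hS⟩ ⟨_, _, hT, _⟩ =>
    (h.at_lt_at ⟨hy₀, hy₁⟩).not_ge (hT.trans hS)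

theorem region_inter_nonempty_of_at_le {S T : Trapezoid} {y : ℝ} (hy : y ∈ Set.Icc (0 : ℝ) 1)
    (hST : S.left.at y ≤ T.right.at y) (hTS : T.left.at y ≤ S.right.at y) :
    (S.region ∩ T.region).Nonempty :=
  ⟨(max (S.left.at y) (T.left.at y), y),
    ⟨hy.1, hy.2, le_max_left _ _, max_le (Seg.at_mono S.top_le S.bot_le hy) hTS⟩,
    ⟨hy.1, hy.2, le_max_right _ _, max_le hST (Seg.at_mono T.top_le T.bot_le hy)⟩⟩

theorem region_inter_nonempty_of_crossing {S T : Trapezoid}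
    (htop : S.right.top < T.left.top) (hbot : T.right.bot < S.left.bot) :
    (S.region ∩ T.region).Nonempty := by
  have hbot' : T.left.bot ≤ S.right.bot := T.bot_le.trans (hbot.le.trans S.bot_le)
  obtain ⟨y, hy, heq⟩ : ∃ y ∈ Set.Icc (0 : ℝ) 1, T.left.at y = S.right.at y :=
    isPreconnected_Icc.intermediate_value₂ (Set.left_mem_Icc.2 zero_le_one)
      (Set.right_mem_Icc.2 zero_le_one) T.left.continuous_at.continuousOn
      S.right.continuous_at.continuousOn (by simpa only [Seg.at_zero] using hbot')
      (by simpa only [Seg.at_one] using htop.le)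
  refine region_inter_nonempty_of_at_le hy ?_ heq.le
  calc S.left.at y ≤ S.right.at y := Seg.at_mono S.top_le S.bot_le hy
    _ = T.left.at y := heq.symm
    _ ≤ T.right.at y := Seg.at_mono T.top_le T.bot_le hy

theorem region_inter_nonempty_iff {S T : Trapezoid} :
    (S.region ∩ T.region).Nonempty ↔ ¬ S.Separated T := by
  refine ⟨fun hne hsep => ?_, fun hsep => ?_⟩
  · rcases hsep with h | h
    · exact hne.ne_empty h.disjoint_region.inter_eq
    · exact hne.ne_empty h.disjoint_region.symm.inter_eq
  by_cases htop : S.left.top ≤ T.right.top ∧ T.left.top ≤ S.right.top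
  · exact region_inter_nonempty_of_at_le (y := 1) (by simp)
      (by simpa only [Seg.at_one] using htop.1) (by simpa only [Seg.at_one] using htop.2)
  by_cases hbot : S.left.bot ≤ T.right.bot ∧ T.left.bot ≤ S.right.bot
  · exact region_inter_nonempty_of_at_le (y := 0) (by simp)
      (by simpa only [Seg.at_zero] using hbot.1) (by simpa only [Seg.at_zero] using hbot.2)
  rw [not_and_or, not_le, not_le] at htop hbot
  rcases htop with ht | ht <;> rcases hbot with hb | hb
  · exact (hsep (Or.inr ⟨ht, hb⟩)).elim
  · rw [Set.inter_comm]
    exact region_inter_nonempty_of_crossing ht hb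
  · exact region_inter_nonempty_of_crossing ht hb
  · exact (hsep (Or.inl ⟨ht, hb⟩)).elim

end Trapezoid

theorem trapezoidGraph_adj_iff {V : Type*} (R : V → Trapezoid) {u v : V} (h : u ≠ v) :
    (trapezoidGraph R).Adj u v ↔ ¬ (R u).Separated (R v) := by
  simp only [trapezoidGraph, ne_eq, h, not_false_eq_true, true_and,
    Trapezoid.region_inter_nonempty_iff]

theorem trapezoidGraph_eq_iff {V : Type*} {R S : V → Trapezoid} :
    trapezoidGraph R = trapezoidGraph S ↔
      ∀ u v, (R u).Separated (R v) ↔ (S u).Separated (S v) := by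
  refine ⟨fun h u v => ?_, fun h => ?_⟩
  · rcases eq_or_ne u v with rfl | huv
    · simp only [Trapezoid.not_separated_self]
    · rw [← not_iff_not, ← trapezoidGraph_adj_iff R huv, h, trapezoidGraph_adj_iff S huv]
  · ext u v
    rcases eq_or_ne u v with rfl | huv
    · simp only [SimpleGraph.irrefl]
    · rw [trapezoidGraph_adj_iff R huv, trapezoidGraph_adj_iff S huv, h]

/-! ### Bounded tolerance graphs are the intersection graphs of parallelograms -/

namespace Trapezoid

/-- The left and the right line are parallel. -/
def IsParallelogram (T : Trapezoid) : Prop := T.left.slope = T.right.slope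

/-- The trapezoid whose side on `L₁` is moved horizontally by `c`. -/
def shear (T : Trapezoid) (c : ℝ) : Trapezoid where
  left := ⟨T.left.top + c, T.left.bot⟩
  right := ⟨T.right.top + c, T.right.bot⟩
  top_le := by simpa only [add_le_add_iff_right] using T.top_le
  bot_le := T.bot_le

theorem separated_shear_iff {S T : Trapezoid} {c : ℝ} :
    (S.shear c).Separated (T.shear c) ↔ S.Separated T := by
  simp only [Separated, LeftOf, Seg.LeftOf, shear, add_lt_add_iff_right]

theorem IsParallelogram.shear {T : Trapezoid} (h : T.IsParallelogram) (c : ℝ) :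
    (T.shear c).IsParallelogram := by
  simp only [IsParallelogram, Seg.slope, Trapezoid.shear] at h ⊢
  linarith

/-- The parallelogram of an interval `[l, r]` with tolerance `t ≤ r - l`: its sides on `L₁` and
`L₂` are `[l + t, r]` and `[l, r - t]`. -/
def ofTolerance (l r t : ℝ) (h : t ≤ r - l) : Trapezoid where
  left := ⟨l + t, l⟩
  right := ⟨r, r - t⟩
  top_le := by linarith
  bot_le := by linarith

theorem isParallelogram_ofTolerance {l r t : ℝ} (h : t ≤ r - l) :
    (ofTolerance l r t h).IsParallelogram := by
  simp only [IsParallelogram, Seg.slope, ofTolerance]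
  ring

/-- The tolerance interval of `T` is `[T.left.bot, T.right.top]`, its tolerance the slope of `T`. -/
theorem min_slope_le_volume_iff {S T : Trapezoid} (hS : S.IsParallelogram)
    (hT : T.IsParallelogram) (hS₀ : 0 < S.left.slope) (hT₀ : 0 < T.left.slope) :
    min S.left.slope T.left.slope ≤ MeasureTheory.volume.real
        (Set.Icc S.left.bot S.right.top ∩ Set.Icc T.left.bot T.right.top) ↔
      ¬ S.Separated T := by
  have htopS := S.top_le
  have htopT := T.top_le
  simp only [IsParallelogram, Separated, LeftOf, Seg.LeftOf, Seg.slope] at *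
  rw [Set.Icc_inter_Icc, Real.volume_real_Icc, le_max_iff, or_iff_left (lt_min hS₀ hT₀).not_ge,
    ← not_iff_not, not_not, not_le, lt_min_iff, sub_lt_iff_lt_add, sub_lt_iff_lt_add]
  simp only [min_lt_iff, ← max_add_add_left, lt_max_iff]
  grind

theorem slope_left_le (T : Trapezoid) : T.left.slope ≤ T.right.top - T.left.bot :=
  sub_le_sub_right T.top_le _

end Trapezoid

theorem IsBoundedToleranceGraph.exists_isParallelogram {V : Type*} {G : SimpleGraph V}
    (hG : IsBoundedToleranceGraph G) :
    ∃ R : V → Trapezoid, (∀ v, (R v).IsParallelogram) ∧ G = trapezoidGraph R := by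
  obtain ⟨l, r, t, ⟨hle, hpos, hadj⟩, hbound⟩ := hG
  have ht (v) : t v ≤ r v - l v := by
    rw [← Real.volume_real_Icc_of_le (hle v)]
    exact hbound v
  let R (v : V) : Trapezoid := Trapezoid.ofTolerance (l v) (r v) (t v) (ht v)
  have hR (v) : (R v).IsParallelogram := Trapezoid.isParallelogram_ofTolerance (ht v)
  have hslope (v) : (R v).left.slope = t v := add_sub_cancel_left _ _
  refine ⟨R, hR, SimpleGraph.ext (funext₂ fun u v => propext ?_)⟩
  rcases eq_or_ne u v with rfl | huv
  · simp only [SimpleGraph.irrefl]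
  rw [hadj u v huv, trapezoidGraph_adj_iff R huv,
    ← Trapezoid.min_slope_le_volume_iff (hR u) (hR v) (by rw [hslope]; exact hpos u)
      (by rw [hslope]; exact hpos v), hslope, hslope]
  rfl

theorem isBoundedToleranceGraph_of_slope_pos {V : Type*} {R : V → Trapezoid}
    (hR : ∀ v, (R v).IsParallelogram) (hpos : ∀ v, 0 < (R v).left.slope) :
    IsBoundedToleranceGraph (trapezoidGraph R) := by
  have hlt (v) : (R v).left.bot < (R v).right.top :=
    sub_pos.1 ((hpos v).trans_le (R v).slope_left_le)
  refine ⟨fun v => (R v).left.bot, fun v => (R v).right.top, fun v => (R v).left.slope,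
    ⟨fun v => (hlt v).le, hpos, fun u v huv => ?_⟩, fun v => ?_⟩
  · rw [trapezoidGraph_adj_iff R huv,
      Trapezoid.min_slope_le_volume_iff (hR u) (hR v) (hpos u) (hpos v)]
  · rw [Real.volume_real_Icc_of_le (hlt v).le]
    exact (R v).slope_left_le

theorem isBoundedToleranceGraph_of_isParallelogram {V : Type*} [Finite V] {R : V → Trapezoid}
    (hR : ∀ v, (R v).IsParallelogram) : IsBoundedToleranceGraph (trapezoidGraph R) := by
  obtain ⟨m, hm⟩ := (Set.finite_range fun v => (R v).left.slope).bddBelow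
  have hgraph : trapezoidGraph R = trapezoidGraph fun v => (R v).shear (1 - m) :=
    trapezoidGraph_eq_iff.2 fun u v => Trapezoid.separated_shear_iff.symm
  rw [hgraph]
  refine isBoundedToleranceGraph_of_slope_pos (fun v => (hR v).shear _) fun v => ?_
  have hv : m ≤ (R v).left.slope := hm ⟨v, rfl⟩
  simp only [Seg.slope, Trapezoid.shear] at hv ⊢
  linarith

/-! ### Paired lines -/

/-- A permutation diagram with integer endpoints, the lines of which are grouped into pairs:
`(w, false)` is the first and `(w, true)` the second line of the pair `w`. -/
structure PairedLines (W : Type*) where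
  top : W × Bool → ℤ
  bot : W × Bool → ℤ
  top_injective : Function.Injective top
  bot_injective : Function.Injective bot
  top_lt : ∀ w, top (w, false) < top (w, true)
  bot_lt : ∀ w, bot (w, false) < bot (w, true)

namespace PairedLines

variable {W : Type*} (P Q : PairedLines W)

/-- The line `g` as a segment between `L₁` and `L₂`. -/
def seg (g : W × Bool) : Seg := ⟨P.top g, P.bot g⟩

/-- The line `g` lies strictly to the left of the line `h`. -/
def Before (g h : W × Bool) : Prop := P.top g < P.top h ∧ P.bot g < P.bot h

/-- The lines `g` and `h` cross. -/
def Crosses (g h : W × Bool) : Prop :=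
  P.top g < P.top h ∧ P.bot h < P.bot g ∨ P.top h < P.top g ∧ P.bot g < P.bot h

/-- The line parallel to the left side of the `i`-th trapezoid of a pair, and its displacement in
sixteenths, that is, in multiples of `ε / 8`. -/
def leftSide : Fin 7 → Bool × ℤ :=
  ![(false, 0), (false, -4), (false, -6), (false, -7), (true, -4), (true, 2), (true, 3)]

/-- The line parallel to the right side of the `i`-th trapezoid of a pair, and its displacement in
sixteenths, that is, in multiples of `ε / 8`. -/
def rightSide : Fin 7 → Bool × ℤ :=
  ![(true, 0), (false, 4), (false, -2), (false, -3), (true, 4), (true, 6), (true, 7)]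

theorem abs_leftSide_lt : ∀ i, |(leftSide i).2| < 8 := by decide

theorem abs_rightSide_lt : ∀ i, |(rightSide i).2| < 8 := by decide

/-- The line of the diagram at the left side of a trapezoid. -/
def leftLine (x : W × Fin 7) : W × Bool := (x.1, (leftSide x.2).1)

/-- The line of the diagram at the right side of a trapezoid. -/
def rightLine (x : W × Fin 7) : W × Bool := (x.1, (rightSide x.2).1)

/-- The representation in which every pair contributes its trapezoid and six parallelograms. -/
noncomputable def rep (x : W × Fin 7) : Trapezoid where
  left := (P.seg (leftLine x)).shift ((leftSide x.2).2 / 16)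
  right := (P.seg (rightLine x)).shift ((rightSide x.2).2 / 16)
  top_le := by
    have htop : (P.top (x.1, false) : ℝ) < P.top (x.1, true) := mod_cast P.top_lt x.1
    obtain ⟨w, i⟩ := x
    fin_cases i <;> simp [seg, leftLine, rightLine, Seg.shift, leftSide, rightSide, htop.le] <;>
      norm_num
  bot_le := by
    have hbot : (P.bot (x.1, false) : ℝ) < P.bot (x.1, true) := mod_cast P.bot_lt x.1
    obtain ⟨w, i⟩ := x
    fin_cases i <;> simp [seg, leftLine, rightLine, Seg.shift, leftSide, rightSide, hbot.le] <;>
      norm_num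

theorem intCast_add_sixteenths_lt_iff {m n d e : ℤ} (hd : |d| < 8) (he : |e| < 8) :
    (m : ℝ) + d / 16 < n + e / 16 ↔ m < n ∨ m = n ∧ d < e := by
  have hscale : (m : ℝ) + d / 16 < n + e / 16 ↔ 16 * m + d < 16 * n + e := by
    rw [← @Int.cast_lt ℝ]
    push_cast
    constructor <;> intro h <;> linarith
  rw [hscale]
  grind

theorem leftOf_rep_iff {x y : W × Fin 7} :
    (P.rep x).LeftOf (P.rep y) ↔ P.Before (rightLine x) (leftLine y) ∨
      rightLine x = leftLine y ∧ (rightSide x.2).2 < (leftSide y.2).2 := by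
  simp only [Trapezoid.LeftOf, Seg.LeftOf, rep, seg, Seg.shift,
    intCast_add_sixteenths_lt_iff (abs_rightSide_lt _) (abs_leftSide_lt _),
    P.top_injective.eq_iff, P.bot_injective.eq_iff, Before]
  grind

variable {P Q} in
theorem trapezoidGraph_rep_congr (h : ∀ g g', P.Before g g' ↔ Q.Before g g') :
    trapezoidGraph P.rep = trapezoidGraph Q.rep :=
  trapezoidGraph_eq_iff.2 fun _ _ => by simp only [Trapezoid.Separated, leftOf_rep_iff, h]

theorem isParallelogram_rep
    (h : ∀ w, (P.seg (w, false)).slope = (P.seg (w, true)).slope) (x : W × Fin 7) :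
    (P.rep x).IsParallelogram := by
  have hslope (g : W × Bool) : (P.seg g).slope = (P.seg (g.1, false)).slope := by
    rcases g with ⟨w, _ | _⟩
    · rfl
    · exact (h w).symm
  rw [Trapezoid.IsParallelogram, rep, Seg.slope_shift, Seg.slope_shift, hslope (leftLine x),
    hslope (rightLine x)]
  rfl

end PairedLines

namespace Monotone3CNF.LiteralOrder

variable {k n : ℕ} {φ : Monotone3CNF k n} (σ : LiteralOrder φ)

/-! ### The lines of literals and links -/

theorem pos_inj {x y : Fin k × Fin 3} : (σ.pos x : ℕ) = σ.pos y ↔ x = y := by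
  rw [← Fin.ext_iff, σ.pos.apply_eq_iff_eq]

theorem var_le_of_pos_le {x y : Fin k × Fin 3} (h : σ.pos x ≤ σ.pos y) :
    φ.var x.1 x.2 ≤ φ.var y.1 y.2 :=
  not_lt.1 fun hlt => (σ.lt_of_var_lt y x hlt).not_ge h

theorem pos_lt_pos (i : Fin k) {j j' : Fin 3} (h : j < j') : σ.pos (i, j) < σ.pos (i, j') :=
  σ.lt_of_var_lt _ _ (φ.strictMono i h)

theorem link_pos_lt (q : σ.Link) : σ.pos q.1.1 < σ.pos q.1.2 :=
  Fin.lt_def.2 (by have := q.2.1; omega)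

theorem link_fst_injective : Function.Injective fun q : σ.Link => q.1.1 := by
  intro q q' h
  have h' : q.1.1 = q'.1.1 := h
  exact Subtype.ext (Prod.ext h' (σ.pos_inj.1 (by rw [q.2.1, q'.2.1, h'])))

theorem link_snd_injective : Function.Injective fun q : σ.Link => q.1.2 := by
  intro q q' h
  have hpos : (σ.pos q.1.1 : ℕ) + 1 = σ.pos q'.1.1 + 1 := by
    rw [← q.2.1, ← q'.2.1]
    exact congrArg (fun x => (σ.pos x : ℕ)) h
  exact σ.link_fst_injective (σ.pos_inj.1 (Nat.succ.inj hpos))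

/-- The abscissa of a slot (one of four) of a literal. -/
def place (e : (Fin k × Fin 3) × Fin 4) : ℤ := 4 * (σ.pos e.1 : ℕ) + (e.2 : ℕ)

theorem place_lt_place_iff {x y : Fin k × Fin 3} {a b : Fin 4} :
    σ.place (x, a) < σ.place (y, b) ↔ σ.pos x < σ.pos y ∨ x = y ∧ a < b := by
  rw [← σ.pos_inj, Fin.lt_def, Fin.lt_def]
  simp only [place]
  omega

theorem place_lt_of_pos_lt {x y : Fin k × Fin 3} (h : σ.pos x < σ.pos y) (a b : Fin 4) :
    σ.place (x, a) < σ.place (y, b) :=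
  σ.place_lt_place_iff.2 (Or.inl h)

theorem place_injective : Function.Injective σ.place := by
  rintro ⟨x, a⟩ ⟨y, b⟩ h
  simp only [place] at h
  obtain rfl : x = y := σ.pos_inj.1 (by omega)
  exact Prod.ext rfl (Fin.ext (by lia))

/-- The literal and its slot at which a line ends on `L₁`. -/
def topPlace : σ.LinePair × Bool → (Fin k × Fin 3) × Fin 4
  | (.ab i, false) => ((i, 0), 0)
  | (.ab i, true) => ((i, 1), 3)
  | (.cd i, false) => ((i, 0), 3)
  | (.cd i, true) => ((i, 2), 0)
  | (.ef i, false) => ((i, 1), 0)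
  | (.ef i, true) => ((i, 2), 3)
  | (.uv q, false) => (q.1.2, 1)
  | (.uv q, true) => (q.1.2, 2)

/-- The literal and its slot at which a line ends on `L₂`. -/
def botPlace : σ.LinePair × Bool → (Fin k × Fin 3) × Fin 4
  | (.ab i, false) => ((i, 0), 3)
  | (.ab i, true) => ((i, 1), 0)
  | (.cd i, false) => ((i, 0), 0)
  | (.cd i, true) => ((i, 2), 3)
  | (.ef i, false) => ((i, 1), 3)
  | (.ef i, true) => ((i, 2), 0)
  | (.uv q, false) => (q.1.1, 1)
  | (.uv q, true) => (q.1.1, 2)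

theorem topPlace_injective : Function.Injective σ.topPlace := by
  rintro ⟨i | i | i | q, _ | _⟩ ⟨i' | i' | i' | q', _ | _⟩ h <;>
    simp_all [topPlace, σ.link_snd_injective.eq_iff]

theorem botPlace_injective : Function.Injective σ.botPlace := by
  rintro ⟨i | i | i | q, _ | _⟩ ⟨i' | i' | i' | q', _ | _⟩ h <;>
    simp_all [botPlace, σ.link_fst_injective.eq_iff]

/-- The line `ℓ¹` of a literal as a member of its pair. -/
def fstLine : Fin k × Fin 3 → σ.LinePair × Bool
  | (i, 0) => (.ab i, false)
  | (i, 1) => (.ef i, false)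
  | (i, 2) => (.cd i, true)

/-- The line `ℓ²` of a literal as a member of its pair. -/
def sndLine : Fin k × Fin 3 → σ.LinePair × Bool
  | (i, 0) => (.cd i, false)
  | (i, 1) => (.ab i, true)
  | (i, 2) => (.ef i, true)

theorem places_fstLine (x : Fin k × Fin 3) :
    σ.topPlace (σ.fstLine x) = (x, 0) ∧ σ.botPlace (σ.fstLine x) = (x, 3) := by
  obtain ⟨i, j⟩ := x
  fin_cases j <;> exact ⟨rfl, rfl⟩

theorem places_sndLine (x : Fin k × Fin 3) :
    σ.topPlace (σ.sndLine x) = (x, 3) ∧ σ.botPlace (σ.sndLine x) = (x, 0) := by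
  obtain ⟨i, j⟩ := x
  fin_cases j <;> exact ⟨rfl, rfl⟩

/-- The permutation representation with its grouping into pairs. -/
def lines : PairedLines σ.LinePair where
  top g := σ.place (σ.topPlace g)
  bot g := σ.place (σ.botPlace g)
  top_injective := σ.place_injective.comp σ.topPlace_injective
  bot_injective := σ.place_injective.comp σ.botPlace_injective
  top_lt
    | .ab i => σ.place_lt_of_pos_lt (σ.pos_lt_pos i (by decide)) _ _
    | .cd i => σ.place_lt_of_pos_lt (σ.pos_lt_pos i (by decide)) _ _
    | .ef i => σ.place_lt_of_pos_lt (σ.pos_lt_pos i (by decide)) _ _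
    | .uv _ => σ.place_lt_place_iff.2 (Or.inr ⟨rfl, by decide⟩)
  bot_lt
    | .ab i => σ.place_lt_of_pos_lt (σ.pos_lt_pos i (by decide)) _ _
    | .cd i => σ.place_lt_of_pos_lt (σ.pos_lt_pos i (by decide)) _ _
    | .ef i => σ.place_lt_of_pos_lt (σ.pos_lt_pos i (by decide)) _ _
    | .uv _ => σ.place_lt_place_iff.2 (Or.inr ⟨rfl, by decide⟩)

theorem seg_lines_false (w : σ.LinePair) : σ.lines.seg (w, false) = σ.leftLine w := by
  rcases w with i | i | i | q <;>
    simp [PairedLines.seg, lines, leftLine, topPlace, botPlace, place, line₁, line₂, lineU]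

theorem seg_lines_true (w : σ.LinePair) : σ.lines.seg (w, true) = σ.rightLine w := by
  rcases w with i | i | i | q <;>
    simp [PairedLines.seg, lines, rightLine, topPlace, botPlace, place, line₁, line₂, lineV]

theorem repH_eq : σ.repH = σ.lines.rep := by
  funext ⟨w, i⟩
  fin_cases i <;>
    norm_num [repH, PairedLines.rep, PairedLines.leftLine, PairedLines.rightLine,
      PairedLines.leftSide, PairedLines.rightSide, seg_lines_false, seg_lines_true, trapezoid,
      Seg.band, Seg.shift, ε]

/-! ### The number of vertices -/

/-- `x` is the last literal of its variable. -/
def IsLast (x : Fin k × Fin 3) : Prop :=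
  ∀ y, (σ.pos y : ℕ) = σ.pos x + 1 → φ.var x.1 x.2 ≠ φ.var y.1 y.2

theorem pos_le_of_isLast {x y : Fin k × Fin 3} (hx : σ.IsLast x)
    (h : φ.var x.1 x.2 = φ.var y.1 y.2) : σ.pos y ≤ σ.pos x := by
  by_contra! hlt
  obtain ⟨z, hz⟩ := σ.pos.surjective ⟨σ.pos x + 1, (Nat.succ_le_of_lt hlt).trans_lt (σ.pos y).2⟩
  have hxz : σ.pos x ≤ σ.pos z := by simp only [hz, Fin.le_def, Nat.le_succ]
  have hzy : σ.pos z ≤ σ.pos y := by simpa only [hz, Fin.le_def] using Nat.succ_le_of_lt hlt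
  exact hx z (by rw [hz]) ((σ.var_le_of_pos_le hxz).antisymm (h ▸ σ.var_le_of_pos_le hzy))

theorem exists_isLast (x : Fin k × Fin 3) :
    ∃ y, σ.IsLast y ∧ φ.var y.1 y.2 = φ.var x.1 x.2 := by
  obtain ⟨y, hy, hmax⟩ := (Set.toFinite {y : Fin k × Fin 3 |
    φ.var y.1 y.2 = φ.var x.1 x.2}).exists_maximalFor σ.pos _ ⟨x, rfl⟩
  refine ⟨y, fun z hz hv => ?_, hy⟩
  have hzy := hmax (j := z) (hv.symm.trans hy) (Fin.le_def.2 (by omega))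
  exact absurd (Fin.le_def.1 hzy) (by omega)

theorem card_isLast :
    Nat.card {x // σ.IsLast x} = (Set.range fun x : Fin k × Fin 3 => φ.var x.1 x.2).ncard := by
  rw [← Nat.card_coe_set_eq]
  refine Nat.card_eq_of_bijective
    (fun x : {x // σ.IsLast x} => (⟨φ.var x.1.1 x.1.2, x.1, rfl⟩ :
      Set.range fun x : Fin k × Fin 3 => φ.var x.1 x.2)) ⟨?_, ?_⟩
  · rintro ⟨x, hx⟩ ⟨y, hy⟩ h
    have hv : φ.var x.1 x.2 = φ.var y.1 y.2 := congrArg Subtype.val h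
    exact Subtype.ext (σ.pos.injective
      (le_antisymm (σ.pos_le_of_isLast hy hv.symm) (σ.pos_le_of_isLast hx hv)))
  · rintro ⟨_, x, rfl⟩
    obtain ⟨y, hy, hv⟩ := σ.exists_isLast x
    exact ⟨⟨y, hy⟩, Subtype.ext hv⟩

theorem card_link : Nat.card σ.Link = Nat.card {x // ¬ σ.IsLast x} := by
  refine Nat.card_eq_of_bijective (fun q : σ.Link => (⟨q.1.1, fun h => h q.1.2 q.2.1 q.2.2⟩ :
    {x // ¬ σ.IsLast x})) ⟨fun q q' h => σ.link_fst_injective (congrArg Subtype.val h), ?_⟩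
  rintro ⟨x, hx⟩
  simp only [IsLast, ne_eq, not_forall, not_not] at hx
  obtain ⟨y, hy, hv⟩ := hx
  exact ⟨⟨(x, y), hy, hv⟩, rfl⟩

theorem card_link_add_card_isLast : Nat.card σ.Link + Nat.card {x // σ.IsLast x} = 3 * k := by
  classical
  rw [card_link, add_comm, Nat.card_eq_fintype_card, Nat.card_eq_fintype_card,
    Fintype.card_subtype_compl, Nat.add_sub_cancel' (Fintype.card_subtype_le _),
    Fintype.card_prod, Fintype.card_fin, Fintype.card_fin, mul_comm]

/-- The pairs of lines as a sum type, for counting them. -/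
def linePairEquiv : σ.LinePair ≃ Fin k ⊕ Fin k ⊕ Fin k ⊕ σ.Link where
  toFun
    | .ab i => .inl i
    | .cd i => .inr (.inl i)
    | .ef i => .inr (.inr (.inl i))
    | .uv q => .inr (.inr (.inr q))
  invFun
    | .inl i => .ab i
    | .inr (.inl i) => .cd i
    | .inr (.inr (.inl i)) => .ef i
    | .inr (.inr (.inr q)) => .uv q
  left_inv := by rintro (i | i | i | q) <;> rfl
  right_inv := by rintro (i | i | i | q) <;> rfl

instance : Finite σ.Link := Subtype.finite

instance : Finite σ.LinePair := Finite.of_equiv _ σ.linePairEquiv.symm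

theorem card_vertices : Nat.card (σ.LinePair × Fin 7) =
    7 * (6 * k - (Set.range fun x : Fin k × Fin 3 => φ.var x.1 x.2).ncard) := by
  have h := σ.card_link_add_card_isLast
  rw [σ.card_isLast] at h
  rw [Nat.card_prod, Nat.card_congr σ.linePairEquiv, Nat.card_sum, Nat.card_sum, Nat.card_sum]
  simp only [Nat.card_eq_fintype_card, Fintype.card_fin] at *
  omega

/-! ### Truth assignments and orders of the pairs -/

variable {σ} in
/-- A literal is true under `τ` if and only if `s` orders the pair of its line `ℓ¹` before the pair
of its line `ℓ²`. -/
def OrdersPairs {α : Type*} [LinearOrder α] (s : σ.LinePair → α) (τ : Fin n → Bool) : Prop :=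
  ∀ x : Fin k × Fin 3, s (σ.fstLine x).1 ≠ s (σ.sndLine x).1 ∧
    (s (σ.fstLine x).1 < s (σ.sndLine x).1 ↔ τ (φ.var x.1 x.2) = true)

/-- The truth values of the literals of a clause orient the triangle formed by the pairs of the
clause. This orientation is acyclic unless the three values agree. -/
theorem exists_ranks (t₀ t₁ t₂ : Bool) (ht : ¬ (t₀ = t₁ ∧ t₁ = t₂)) :
    ∃ a b c : Fin 3, (a ≠ b ∧ (a < b ↔ t₀ = true)) ∧ (c ≠ a ∧ (c < a ↔ t₁ = true)) ∧
      (b ≠ c ∧ (b < c ↔ t₂ = true)) := by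
  revert t₀ t₁ t₂
  decide

theorem not_all_eq_of_nae {t : Fin 3 → Bool} (ht : (∃ j, t j = true) ∧ ∃ j, t j = false) :
    ¬ (t 0 = t 1 ∧ t 1 = t 2) := by
  rintro ⟨h₀₁, h₁₂⟩
  have hconst (j : Fin 3) : t j = t 2 := by fin_cases j <;> simp [h₀₁, h₁₂]
  obtain ⟨⟨j, hj⟩, ⟨j', hj'⟩⟩ := ht
  rw [hconst] at hj hj'
  exact Bool.false_ne_true (hj'.symm.trans hj)

theorem exists_ordersPairs {τ : Fin n → Bool}
    (hτ : ∀ i, (∃ j, τ (φ.var i j) = true) ∧ ∃ j, τ (φ.var i j) = false) :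
    ∃ s : σ.LinePair → Fin 3, OrdersPairs s τ := by
  choose a b c h using fun i => exists_ranks _ _ _ (not_all_eq_of_nae (hτ i))
  let s : σ.LinePair → Fin 3
    | .ab i => a i
    | .cd i => b i
    | .ef i => c i
    | .uv _ => 0
  refine ⟨s, fun ⟨i, j⟩ => ?_⟩
  fin_cases j
  exacts [(h i).1, (h i).2.1, (h i).2.2]

variable {σ} in
theorem OrdersPairs.nae {α : Type*} [LinearOrder α] {s : σ.LinePair → α} {τ : Fin n → Bool}
    (h : OrdersPairs s τ) (i : Fin k) :
    (∃ j, τ (φ.var i j) = true) ∧ ∃ j, τ (φ.var i j) = false := by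
  have h₀ : _ ∧ (s (.ab i) < s (.cd i) ↔ _) := h (i, 0)
  have h₁ : _ ∧ (s (.ef i) < s (.ab i) ↔ _) := h (i, 1)
  have h₂ : _ ∧ (s (.cd i) < s (.ef i) ↔ _) := h (i, 2)
  constructor
  · by_contra! hfalse
    have hle {a b : σ.LinePair} {j : Fin 3} (hj : s a < s b ↔ τ (φ.var i j) = true) : s b ≤ s a :=
      not_lt.1 fun hlt => hfalse j (hj.1 hlt)
    exact h₀.1 (le_antisymm ((hle h₂.2).trans' (hle h₁.2)) (hle h₀.2))
  · by_contra! htrue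
    have hlt {a b : σ.LinePair} {j : Fin 3} (hj : s a < s b ↔ τ (φ.var i j) = true) : s a < s b :=
      hj.2 (Bool.eq_true_of_not_eq_false (htrue j))
    exact lt_irrefl _ ((hlt h₀.2).trans ((hlt h₂.2).trans (hlt h₁.2)))

/-! ### From an assignment to parallelograms -/

/-- The variable to which a line belongs. -/
def lineVar (g : σ.LinePair × Bool) : Fin n := φ.var (σ.topPlace g).1.1 (σ.topPlace g).1.2

theorem var_botPlace (g : σ.LinePair × Bool) :
    φ.var (σ.botPlace g).1.1 (σ.botPlace g).1.2 = σ.lineVar g := by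
  rcases g with ⟨_ | _ | _ | q, _ | _⟩
  all_goals first | rfl | exact q.2.2

/-- The place on `L₁` of a line after the lines of the false variables are turned upside down. -/
def flipTop (τ : Fin n → Bool) (g : σ.LinePair × Bool) : (Fin k × Fin 3) × Fin 4 :=
  if τ (σ.lineVar g) then σ.topPlace g else σ.botPlace g

/-- The place on `L₂` of a line after the lines of the false variables are turned upside down. -/
def flipBot (τ : Fin n → Bool) (g : σ.LinePair × Bool) : (Fin k × Fin 3) × Fin 4 :=
  if τ (σ.lineVar g) then σ.botPlace g else σ.topPlace g

theorem var_flipTop (τ : Fin n → Bool) (g : σ.LinePair × Bool) :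
    φ.var (σ.flipTop τ g).1.1 (σ.flipTop τ g).1.2 = σ.lineVar g := by
  rw [flipTop]
  split_ifs
  exacts [rfl, σ.var_botPlace g]

theorem var_flipBot (τ : Fin n → Bool) (g : σ.LinePair × Bool) :
    φ.var (σ.flipBot τ g).1.1 (σ.flipBot τ g).1.2 = σ.lineVar g := by
  rw [flipBot]
  split_ifs
  exacts [σ.var_botPlace g, rfl]

theorem flipTop_injective (τ : Fin n → Bool) : Function.Injective (σ.flipTop τ) := by
  intro g h hgh
  have hvar : σ.lineVar g = σ.lineVar h := by rw [← σ.var_flipTop τ, hgh, σ.var_flipTop]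
  rw [flipTop, flipTop, hvar] at hgh
  split_ifs at hgh
  exacts [σ.topPlace_injective hgh, σ.botPlace_injective hgh]

theorem flipBot_injective (τ : Fin n → Bool) : Function.Injective (σ.flipBot τ) := by
  intro g h hgh
  have hvar : σ.lineVar g = σ.lineVar h := by rw [← σ.var_flipBot τ, hgh, σ.var_flipBot]
  rw [flipBot, flipBot, hvar] at hgh
  split_ifs at hgh
  exacts [σ.botPlace_injective hgh, σ.topPlace_injective hgh]

/-- Lines of different variables do not cross. -/
theorem place_flip_lt_iff (τ : Fin n → Bool) (g h : σ.LinePair × Bool) :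
    (σ.place (σ.flipTop τ g) < σ.place (σ.flipTop τ h) ∧
      σ.place (σ.flipBot τ g) < σ.place (σ.flipBot τ h)) ↔ σ.lines.Before g h := by
  have hlt {g h : σ.LinePair × Bool} (hgh : σ.lineVar g < σ.lineVar h)
      {e e' : (Fin k × Fin 3) × Fin 4} (he : φ.var e.1.1 e.1.2 = σ.lineVar g)
      (he' : φ.var e'.1.1 e'.1.2 = σ.lineVar h) : σ.place e < σ.place e' :=
    σ.place_lt_of_pos_lt (σ.lt_of_var_lt _ _ (by rwa [he, he'])) _ _
  rcases lt_trichotomy (σ.lineVar g) (σ.lineVar h) with hgh | hgh | hgh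
  · exact iff_of_true
      ⟨hlt hgh (σ.var_flipTop τ g) (σ.var_flipTop τ h),
        hlt hgh (σ.var_flipBot τ g) (σ.var_flipBot τ h)⟩
      ⟨hlt hgh rfl rfl, hlt hgh (σ.var_botPlace g) (σ.var_botPlace h)⟩
  · rw [flipTop, flipTop, flipBot, flipBot, hgh]
    split_ifs
    exacts [Iff.rfl, and_comm]
  · exact iff_of_false
      (fun hc => lt_asymm hc.1 (hlt hgh (σ.var_flipTop τ h) (σ.var_flipTop τ g)))
      fun hc => lt_asymm hc.1 (hlt hgh rfl rfl)

/-- Offsets of the four slots of a literal: on lines that end at the slots `a` on `L₁` and `3 - a`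
on `L₂`, they produce the slope `8 * lo` for `a = 0` and `8 * hi` for `a = 3`. -/
def slotOffset (lo hi : Fin 3) : Fin 4 → ℤ :=
  ![4 * (lo : ℕ), 2 * (lo + hi : ℕ) - 1, 2 * (lo + hi : ℕ) + 1, 4 * (hi : ℕ)]

theorem slotOffset_strictMono {lo hi : Fin 3} (h : lo < hi) : StrictMono (slotOffset lo hi) := by
  intro a b
  revert lo hi a b
  decide

theorem slotOffset_mem_Icc {lo hi : Fin 3} (h : lo < hi) (a : Fin 4) :
    0 ≤ slotOffset lo hi a ∧ slotOffset lo hi a ≤ 8 := by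
  revert lo hi a
  decide

variable {σ} in
/-- The displacement of a slot of the literal `x` when the lines are tilted according to `s`. -/
def tilt (s : σ.LinePair → Fin 3) (e : (Fin k × Fin 3) × Fin 4) : ℤ :=
  slotOffset (min (s (σ.fstLine e.1).1) (s (σ.sndLine e.1).1))
    (max (s (σ.fstLine e.1).1) (s (σ.sndLine e.1).1)) e.2

namespace OrdersPairs

variable {σ} {s : σ.LinePair → Fin 3} {τ : Fin n → Bool}

theorem tilt_lt_tilt_iff (hs : OrdersPairs s τ) {x : Fin k × Fin 3} {a b : Fin 4} :
    tilt s (x, a) < tilt s (x, b) ↔ a < b :=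
  (slotOffset_strictMono (min_lt_max.2 (hs x).1)).lt_iff_lt

theorem tilt_mem_Icc (hs : OrdersPairs s τ) (e : (Fin k × Fin 3) × Fin 4) :
    0 ≤ tilt s e ∧ tilt s e ≤ 8 :=
  slotOffset_mem_Icc (min_lt_max.2 (hs e.1).1) e.2

end OrdersPairs

theorem injective_of_lt_iff_place_lt {f : (Fin k × Fin 3) × Fin 4 → ℤ}
    (hf : ∀ e e', f e < f e' ↔ σ.place e < σ.place e') : Function.Injective f := fun e e' h =>
  σ.place_injective (le_antisymm (not_lt.1 (mt (hf e' e).2 h.not_gt))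
    (not_lt.1 (mt (hf e e').2 h.not_lt)))

variable {σ}

/-- The abscissa on `L₁` of a place after tilting the lines according to `s`. -/
def tiltTop (s : σ.LinePair → Fin 3) (e : (Fin k × Fin 3) × Fin 4) : ℤ :=
  16 * (σ.pos e.1 : ℕ) + tilt s e

/-- The abscissa on `L₂` of a place after tilting the lines according to `s`. -/
def tiltBot (s : σ.LinePair → Fin 3) (e : (Fin k × Fin 3) × Fin 4) : ℤ :=
  16 * (σ.pos e.1 : ℕ) - tilt s (e.1, e.2.rev)

theorem tiltTop_zero_sub_tiltBot_three (s : σ.LinePair → Fin 3) (x : Fin k × Fin 3) :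
    (tiltTop s (x, 0) - tiltBot s (x, 3) : ℝ) =
      8 * (min (s (σ.fstLine x).1) (s (σ.sndLine x).1)).val := by
  simp only [tiltTop, tiltBot, tilt, slotOffset, Fin.reduceRev, Matrix.cons_val]
  push_cast
  ring

theorem tiltTop_three_sub_tiltBot_zero (s : σ.LinePair → Fin 3) (x : Fin k × Fin 3) :
    (tiltTop s (x, 3) - tiltBot s (x, 0) : ℝ) =
      8 * (max (s (σ.fstLine x).1) (s (σ.sndLine x).1)).val := by
  simp only [tiltTop, tiltBot, tilt, slotOffset, Fin.reduceRev, Matrix.cons_val]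
  push_cast
  ring

theorem tiltTop_two (s : σ.LinePair → Fin 3) (x : Fin k × Fin 3) :
    tiltTop s (x, 2) = tiltTop s (x, 1) + 2 := by
  simp only [tiltTop, tilt, slotOffset, Matrix.cons_val]
  ring

theorem tiltBot_two (s : σ.LinePair → Fin 3) (x : Fin k × Fin 3) :
    tiltBot s (x, 2) = tiltBot s (x, 1) + 2 := by
  simp only [tiltBot, tilt, slotOffset, Fin.reduceRev, Matrix.cons_val]
  ring

namespace OrdersPairs

variable {s : σ.LinePair → Fin 3} {τ : Fin n → Bool}

theorem tiltTop_lt_tiltTop_iff (hs : OrdersPairs s τ) {e e' : (Fin k × Fin 3) × Fin 4} :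
    tiltTop s e < tiltTop s e' ↔ σ.place e < σ.place e' := by
  obtain ⟨x, a⟩ := e
  obtain ⟨y, b⟩ := e'
  simp only [tiltTop, place_lt_place_iff]
  rcases eq_or_ne x y with rfl | hxy
  · simp only [add_lt_add_iff_left, hs.tilt_lt_tilt_iff, lt_irrefl, true_and, false_or]
  · have hpos := mt σ.pos_inj.1 hxy
    have := hs.tilt_mem_Icc (x, a)
    have := hs.tilt_mem_Icc (y, b)
    simp only [hxy, false_and, or_false, Fin.lt_def]
    omega

theorem tiltBot_lt_tiltBot_iff (hs : OrdersPairs s τ) {e e' : (Fin k × Fin 3) × Fin 4} :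
    tiltBot s e < tiltBot s e' ↔ σ.place e < σ.place e' := by
  obtain ⟨x, a⟩ := e
  obtain ⟨y, b⟩ := e'
  simp only [tiltBot, place_lt_place_iff]
  rcases eq_or_ne x y with rfl | hxy
  · simp only [sub_lt_sub_iff_left, hs.tilt_lt_tilt_iff, Fin.rev_lt_rev, lt_irrefl, true_and,
      false_or]
  · have hpos := mt σ.pos_inj.1 hxy
    have := hs.tilt_mem_Icc (x, a.rev)
    have := hs.tilt_mem_Icc (y, b.rev)
    simp only [hxy, false_and, or_false, Fin.lt_def]
    omega

theorem tiltTop_injective (hs : OrdersPairs s τ) : Function.Injective (tiltTop s) :=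
  σ.injective_of_lt_iff_place_lt fun _ _ => hs.tiltTop_lt_tiltTop_iff

theorem tiltBot_injective (hs : OrdersPairs s τ) : Function.Injective (tiltBot s) :=
  σ.injective_of_lt_iff_place_lt fun _ _ => hs.tiltBot_lt_tiltBot_iff

theorem tilt_flip_lt_iff (hs : OrdersPairs s τ) (g h : σ.LinePair × Bool) :
    (tiltTop s (σ.flipTop τ g) < tiltTop s (σ.flipTop τ h) ∧
      tiltBot s (σ.flipBot τ g) < tiltBot s (σ.flipBot τ h)) ↔ σ.lines.Before g h := by
  rw [hs.tiltTop_lt_tiltTop_iff, hs.tiltBot_lt_tiltBot_iff, place_flip_lt_iff]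

/-- The permutation representation after turning the lines of the false variables upside down and
tilting all lines according to `s`. -/
def tiltedLines (hs : OrdersPairs s τ) : PairedLines σ.LinePair where
  top g := tiltTop s (σ.flipTop τ g)
  bot g := tiltBot s (σ.flipBot τ g)
  top_injective := hs.tiltTop_injective.comp (σ.flipTop_injective τ)
  bot_injective := hs.tiltBot_injective.comp (σ.flipBot_injective τ)
  top_lt w := ((hs.tilt_flip_lt_iff (w, false) (w, true)).2
    ⟨σ.lines.top_lt w, σ.lines.bot_lt w⟩).1
  bot_lt w := ((hs.tilt_flip_lt_iff (w, false) (w, true)).2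
    ⟨σ.lines.top_lt w, σ.lines.bot_lt w⟩).2

theorem before_tiltedLines_iff (hs : OrdersPairs s τ) (g h : σ.LinePair × Bool) :
    hs.tiltedLines.Before g h ↔ σ.lines.Before g h :=
  hs.tilt_flip_lt_iff g h

theorem slope_tiltedLines_fstLine (hs : OrdersPairs s τ) (x : Fin k × Fin 3) :
    (hs.tiltedLines.seg (σ.fstLine x)).slope = 8 * (s (σ.fstLine x).1 : ℕ) := by
  obtain ⟨htop, hbot⟩ := σ.places_fstLine x
  simp only [Seg.slope, PairedLines.seg, tiltedLines, flipTop, flipBot, lineVar, htop, hbot]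
  split_ifs with hτ
  · rw [tiltTop_zero_sub_tiltBot_three, min_eq_left ((hs x).2.2 hτ).le]
  · rw [tiltTop_three_sub_tiltBot_zero, max_eq_left (not_lt.1 (mt (hs x).2.1 hτ))]

theorem slope_tiltedLines_sndLine (hs : OrdersPairs s τ) (x : Fin k × Fin 3) :
    (hs.tiltedLines.seg (σ.sndLine x)).slope = 8 * (s (σ.sndLine x).1 : ℕ) := by
  obtain ⟨htop, hbot⟩ := σ.places_sndLine x
  simp only [Seg.slope, PairedLines.seg, tiltedLines, flipTop, flipBot, lineVar, htop, hbot]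
  split_ifs with hτ
  · rw [tiltTop_three_sub_tiltBot_zero, max_eq_right ((hs x).2.2 hτ).le]
  · rw [tiltTop_zero_sub_tiltBot_three, min_eq_right (not_lt.1 (mt (hs x).2.1 hτ))]

theorem slope_tiltedLines_link (hs : OrdersPairs s τ) (q : σ.Link) :
    (hs.tiltedLines.seg (.uv q, false)).slope = (hs.tiltedLines.seg (.uv q, true)).slope := by
  have hvar : σ.lineVar (.uv q, false) = σ.lineVar (.uv q, true) := rfl
  simp only [Seg.slope, PairedLines.seg, tiltedLines, flipTop, flipBot, hvar, topPlace, botPlace]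
  split_ifs <;>
  · rw [tiltTop_two, tiltBot_two]
    push_cast
    ring

theorem slope_tiltedLines (hs : OrdersPairs s τ) : ∀ w : σ.LinePair,
    (hs.tiltedLines.seg (w, false)).slope = (hs.tiltedLines.seg (w, true)).slope
  | .ab i => (hs.slope_tiltedLines_fstLine (i, 0)).trans (hs.slope_tiltedLines_sndLine (i, 1)).symm
  | .cd i => (hs.slope_tiltedLines_sndLine (i, 0)).trans (hs.slope_tiltedLines_fstLine (i, 2)).symm
  | .ef i => (hs.slope_tiltedLines_fstLine (i, 1)).trans (hs.slope_tiltedLines_sndLine (i, 2)).symm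
  | .uv q => hs.slope_tiltedLines_link q

end OrdersPairs

variable (σ)

theorem isBoundedToleranceGraph_of_naeSatisfiable (hφ : φ.NAESatisfiable) :
    IsBoundedToleranceGraph σ.graphH := by
  obtain ⟨τ, hτ⟩ := hφ
  obtain ⟨s, hs⟩ := σ.exists_ordersPairs hτ
  rw [graphH, repH_eq,
    PairedLines.trapezoidGraph_rep_congr fun g h => (hs.before_tiltedLines_iff g h).symm]
  exact isBoundedToleranceGraph_of_isParallelogram
    (hs.tiltedLines.isParallelogram_rep hs.slope_tiltedLines)

end Monotone3CNF.LiteralOrder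

/-! ### Orientations forced by intersections -/

namespace Seg

theorem cross_of_not_leftOf {a b c d : Seg} (hab : a.LeftOf b) (hcd : c.LeftOf d)
    (had : ¬ a.LeftOf d) (hcb : ¬ c.LeftOf b) :
    (b.top ≤ c.top ∧ d.bot ≤ a.bot) ∨ (d.top ≤ a.top ∧ b.bot ≤ c.bot) := by
  simp only [LeftOf, not_and_or, not_lt] at *
  grind

end Seg

namespace Trapezoid

theorem leftOf_congr_right {S T U : Trapezoid} (hT : S.Separated T) (hU : S.Separated U)
    (h : ¬ T.Separated U) : S.LeftOf T ↔ S.LeftOf U :=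
  ⟨fun hST => hU.resolve_right fun hUS => h (Or.inr (hUS.trans hST)),
    fun hSU => hT.resolve_right fun hTS => h (Or.inl (hTS.trans hSU))⟩

theorem leftOf_congr_left {S T U : Trapezoid} (hT : T.Separated S) (hU : U.Separated S)
    (h : ¬ T.Separated U) : T.LeftOf S ↔ U.LeftOf S :=
  ⟨fun hTS => hU.resolve_right fun hSU => h (Or.inl (hTS.trans hSU)),
    fun hUS => hT.resolve_right fun hST => h (Or.inr (hUS.trans hST))⟩

/-- The trapezoid with its sides on `L₁` and `L₂` exchanged. -/
def flip (T : Trapezoid) : Trapezoid where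
  left := ⟨T.left.bot, T.left.top⟩
  right := ⟨T.right.bot, T.right.top⟩
  top_le := T.bot_le
  bot_le := T.top_le

/-- The trapezoid after a half-turn, which preserves the slopes of its lines. -/
def rotate (T : Trapezoid) : Trapezoid where
  left := ⟨-T.right.bot, -T.right.top⟩
  right := ⟨-T.left.bot, -T.left.top⟩
  top_le := neg_le_neg T.bot_le
  bot_le := neg_le_neg T.top_le

theorem leftOf_flip_iff {S T : Trapezoid} : S.flip.LeftOf T.flip ↔ S.LeftOf T := and_comm

theorem leftOf_rotate_iff {S T : Trapezoid} : S.rotate.LeftOf T.rotate ↔ T.LeftOf S := by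
  simp only [LeftOf, Seg.LeftOf, rotate, neg_lt_neg_iff, and_comm]

theorem trapezoidGraph_flip {V : Type*} (R : V → Trapezoid) :
    trapezoidGraph (fun v => (R v).flip) = trapezoidGraph R :=
  trapezoidGraph_eq_iff.2 fun _ _ => or_congr leftOf_flip_iff leftOf_flip_iff

theorem trapezoidGraph_rotate {V : Type*} (R : V → Trapezoid) :
    trapezoidGraph (fun v => (R v).rotate) = trapezoidGraph R :=
  trapezoidGraph_eq_iff.2 fun _ _ => (or_congr leftOf_rotate_iff leftOf_rotate_iff).trans or_comm

theorem slope_left_flip (T : Trapezoid) : T.flip.left.slope = -T.left.slope :=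
  (neg_sub _ _).symm

theorem IsParallelogram.slope_left_rotate {T : Trapezoid} (h : T.IsParallelogram) :
    T.rotate.left.slope = T.left.slope :=
  (neg_sub_neg _ _).trans h.symm

theorem IsParallelogram.flip {T : Trapezoid} (h : T.IsParallelogram) :
    T.flip.IsParallelogram :=
  (slope_left_flip T).trans ((congrArg Neg.neg h).trans (neg_sub _ _))

theorem IsParallelogram.rotate {T : Trapezoid} (h : T.IsParallelogram) :
    T.rotate.IsParallelogram :=
  h.slope_left_rotate.trans (neg_sub_neg _ _).symm

end Trapezoid

namespace PairedLines

variable {W : Type*} {P : PairedLines W}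

theorem Before.asymm {g h : W × Bool} (hgh : P.Before g h) : ¬ P.Before h g :=
  fun hhg => hgh.1.asymm hhg.1

theorem not_before_self (g : W × Bool) : ¬ P.Before g g := fun h => lt_irrefl _ h.1

theorem before_pair (w : W) : P.Before (w, false) (w, true) := ⟨P.top_lt w, P.bot_lt w⟩

theorem Crosses.symm {g h : W × Bool} (hgh : P.Crosses g h) : P.Crosses h g := Or.symm hgh

/-- The vertex whose trapezoid ends just before the gap at a line. -/
def lo : W × Bool → W × Fin 7
  | (w, false) => (w, 2)
  | (w, true) => (w, 0)

/-- The vertex whose parallelogram covers the gap at a line. -/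
def mid : W × Bool → W × Fin 7
  | (w, false) => (w, 1)
  | (w, true) => (w, 4)

/-- The vertex whose trapezoid starts just after the gap at a line. -/
def hi : W × Bool → W × Fin 7
  | (w, false) => (w, 0)
  | (w, true) => (w, 5)

theorem rightLine_lo (g : W × Bool) : rightLine (lo g) = g := by
  obtain ⟨w, _ | _⟩ := g <;> rfl

theorem leftLine_mid (g : W × Bool) : leftLine (mid g) = g := by
  obtain ⟨w, _ | _⟩ := g <;> rfl

theorem rightLine_mid (g : W × Bool) : rightLine (mid g) = g := by
  obtain ⟨w, _ | _⟩ := g <;> rfl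

theorem leftLine_hi (g : W × Bool) : leftLine (hi g) = g := by
  obtain ⟨w, _ | _⟩ := g <;> rfl

variable (P) in
/-- The line `g` lies weakly between the lines at the sides of the trapezoid of `x`. -/
structure Meets (x : W × Fin 7) (g : W × Bool) : Prop where
  left_top : P.top (leftLine x) ≤ P.top g
  left_bot : P.bot (leftLine x) ≤ P.bot g
  top_right : P.top g ≤ P.top (rightLine x)
  bot_right : P.bot g ≤ P.bot (rightLine x)

theorem meets_lo (g : W × Bool) : P.Meets (lo g) g := by
  obtain ⟨w, _ | _⟩ := g
  exacts [⟨le_rfl, le_rfl, le_rfl, le_rfl⟩, ⟨(P.top_lt w).le, (P.bot_lt w).le, le_rfl, le_rfl⟩]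

theorem meets_mid (g : W × Bool) : P.Meets (mid g) g := by
  obtain ⟨w, _ | _⟩ := g <;> exact ⟨le_rfl, le_rfl, le_rfl, le_rfl⟩

theorem meets_hi (g : W × Bool) : P.Meets (hi g) g := by
  obtain ⟨w, _ | _⟩ := g
  exacts [⟨le_rfl, le_rfl, (P.top_lt w).le, (P.bot_lt w).le⟩, ⟨le_rfl, le_rfl, le_rfl, le_rfl⟩]

theorem Meets.le_of_leftOf {x y : W × Fin 7} {g h : W × Bool} (hx : P.Meets x g)
    (hy : P.Meets y h) (hxy : (P.rep x).LeftOf (P.rep y)) :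
    P.top g ≤ P.top h ∧ P.bot g ≤ P.bot h := by
  have hle : P.top (rightLine x) ≤ P.top (leftLine y) ∧
      P.bot (rightLine x) ≤ P.bot (leftLine y) := by
    rcases P.leftOf_rep_iff.1 hxy with hb | ⟨heq, -⟩
    · exact ⟨hb.1.le, hb.2.le⟩
    · rw [heq]
      exact ⟨le_rfl, le_rfl⟩
  exact ⟨hx.top_right.trans (hle.1.trans hy.left_top),
    hx.bot_right.trans (hle.2.trans hy.left_bot)⟩

theorem Crosses.not_separated {g h : W × Bool} (hgh : P.Crosses g h) {x y : W × Fin 7}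
    (hx : P.Meets x g) (hy : P.Meets y h) : ¬ (P.rep x).Separated (P.rep y) := by
  rintro (hxy | hyx)
  · have hle := hx.le_of_leftOf hy hxy
    exact hgh.elim (fun hc => hc.2.not_ge hle.2) fun hc => hc.1.not_ge hle.1
  · have hle := hy.le_of_leftOf hx hyx
    exact hgh.elim (fun hc => hc.1.not_ge hle.1) fun hc => hc.2.not_ge hle.2

theorem Before.separated {x y : W × Fin 7} (h : P.Before (rightLine x) (leftLine y)) :
    (P.rep x).Separated (P.rep y) :=
  Or.inl (P.leftOf_rep_iff.2 (Or.inl h))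

theorem separated_lo_hi (g : W × Bool) : (P.rep (lo g)).Separated (P.rep (hi g)) := by
  refine Or.inl (P.leftOf_rep_iff.2 (Or.inr ⟨by rw [rightLine_lo, leftLine_hi], ?_⟩))
  obtain ⟨w, _ | _⟩ := g <;> simp [lo, hi, rightSide, leftSide]

theorem not_separated_lo_mid (g : W × Bool) : ¬ (P.rep (lo g)).Separated (P.rep (mid g)) := by
  have hw : ¬ P.Before (g.1, true) (g.1, false) := (before_pair g.1).asymm
  rw [Trapezoid.Separated, P.leftOf_rep_iff, P.leftOf_rep_iff]
  obtain ⟨w, _ | _⟩ := g <;>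
    simp [lo, mid, rightLine, leftLine, rightSide, leftSide, hw, not_before_self]

theorem not_separated_mid_hi (g : W × Bool) : ¬ (P.rep (mid g)).Separated (P.rep (hi g)) := by
  have hw : ¬ P.Before (g.1, true) (g.1, false) := (before_pair g.1).asymm
  rw [Trapezoid.Separated, P.leftOf_rep_iff, P.leftOf_rep_iff]
  obtain ⟨w, _ | _⟩ := g <;>
    simp [mid, hi, rightLine, leftLine, rightSide, leftSide, hw, not_before_self]

theorem not_separated_mid_of_between {w : W} {h : W × Bool} (h₁ : P.Before (w, false) h)
    (h₂ : P.Before h (w, true)) : ¬ (P.rep (mid h)).Separated (P.rep (w, 0)) := by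
  rw [Trapezoid.Separated, P.leftOf_rep_iff, P.leftOf_rep_iff, rightLine_mid, leftLine_mid]
  rintro ((hb | ⟨rfl, -⟩) | hb | ⟨rfl, -⟩)
  exacts [h₁.asymm hb, not_before_self _ h₁, h₂.asymm hb, not_before_self _ h₂]

variable {R : W × Fin 7 → Trapezoid} {g h h' : W × Bool} {w : W}

variable (R) in
/-- In the representation `R` the line `g` lies to the left of the line `h`. -/
def Oriented (g h : W × Bool) : Prop := (R (mid g)).LeftOf (R (mid h))

variable (R) in
/-- In the representation `R` the gap at the line `g` opens from left to right, as in the given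
diagram. -/
def HasGap (g : W × Bool) : Prop := (R (lo g)).LeftOf (R (hi g))

theorem leftOf_congr_right (hR : trapezoidGraph R = trapezoidGraph P.rep) {x y z : W × Fin 7}
    (hy : (P.rep x).Separated (P.rep y)) (hz : (P.rep x).Separated (P.rep z))
    (h : ¬ (P.rep y).Separated (P.rep z)) : (R x).LeftOf (R y) ↔ (R x).LeftOf (R z) :=
  have hsep := trapezoidGraph_eq_iff.1 hR
  Trapezoid.leftOf_congr_right ((hsep _ _).2 hy) ((hsep _ _).2 hz) (mt (hsep _ _).1 h)

theorem leftOf_congr_left (hR : trapezoidGraph R = trapezoidGraph P.rep) {x y z : W × Fin 7}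
    (hy : (P.rep y).Separated (P.rep x)) (hz : (P.rep z).Separated (P.rep x))
    (h : ¬ (P.rep y).Separated (P.rep z)) : (R y).LeftOf (R x) ↔ (R z).LeftOf (R x) :=
  have hsep := trapezoidGraph_eq_iff.1 hR
  Trapezoid.leftOf_congr_left ((hsep _ _).2 hy) ((hsep _ _).2 hz) (mt (hsep _ _).1 h)

theorem not_separated_of_crosses (hR : trapezoidGraph R = trapezoidGraph P.rep)
    (hgh : P.Crosses g h) {x y : W × Fin 7} (hx : P.Meets x g) (hy : P.Meets y h) :
    ¬ (R x).Separated (R y) :=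
  mt (trapezoidGraph_eq_iff.1 hR x y).1 (hgh.not_separated hx hy)

theorem Before.separated_mid_mid (hgh : P.Before g h) :
    (P.rep (mid g)).Separated (P.rep (mid h)) :=
  Before.separated (by rwa [rightLine_mid, leftLine_mid])

theorem Before.separated_lo_mid (hgh : P.Before g h) :
    (P.rep (lo g)).Separated (P.rep (mid h)) :=
  Before.separated (by rwa [rightLine_lo, leftLine_mid])

theorem Before.separated_mid_hi (hgh : P.Before g h) :
    (P.rep (mid g)).Separated (P.rep (hi h)) :=
  Before.separated (by rwa [rightLine_mid, leftLine_hi])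

theorem Before.separated_lo_hi (hgh : P.Before g h) :
    (P.rep (lo g)).Separated (P.rep (hi h)) :=
  Before.separated (by rwa [rightLine_lo, leftLine_hi])

theorem oriented_iff_lo_mid (hR : trapezoidGraph R = trapezoidGraph P.rep) (hgh : P.Before g h) :
    Oriented R g h ↔ (R (lo g)).LeftOf (R (mid h)) :=
  (leftOf_congr_left hR hgh.separated_lo_mid hgh.separated_mid_mid (not_separated_lo_mid g)).symm

theorem oriented_iff_mid_hi (hR : trapezoidGraph R = trapezoidGraph P.rep) (hgh : P.Before g h) :
    Oriented R g h ↔ (R (mid g)).LeftOf (R (hi h)) :=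
  leftOf_congr_right hR hgh.separated_mid_mid hgh.separated_mid_hi (not_separated_mid_hi h)

theorem oriented_iff_lo_hi (hR : trapezoidGraph R = trapezoidGraph P.rep) (hgh : P.Before g h) :
    Oriented R g h ↔ (R (lo g)).LeftOf (R (hi h)) :=
  (oriented_iff_lo_mid hR hgh).trans
    (leftOf_congr_right hR hgh.separated_lo_mid hgh.separated_lo_hi (not_separated_mid_hi h))

theorem Crosses.oriented_congr_right (hR : trapezoidGraph R = trapezoidGraph P.rep)
    (hh : P.Crosses h h') (h₁ : P.Before g h) (h₂ : P.Before g h') :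
    Oriented R g h ↔ Oriented R g h' :=
  leftOf_congr_right hR h₁.separated_mid_mid h₂.separated_mid_mid
    (hh.not_separated (meets_mid h) (meets_mid h'))

theorem Crosses.oriented_congr_left (hR : trapezoidGraph R = trapezoidGraph P.rep)
    (hh : P.Crosses h h') (h₁ : P.Before h g) (h₂ : P.Before h' g) :
    Oriented R h g ↔ Oriented R h' g :=
  leftOf_congr_left hR h₁.separated_mid_mid h₂.separated_mid_mid
    (hh.not_separated (meets_mid h) (meets_mid h'))

theorem oriented_pair_iff_hasGap_false (hR : trapezoidGraph R = trapezoidGraph P.rep) (w : W) :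
    Oriented R (w, false) (w, true) ↔ HasGap R (w, false) :=
  (oriented_iff_lo_mid hR (before_pair w)).trans
    (leftOf_congr_right hR (before_pair w).separated_lo_mid (separated_lo_hi (w, false))
      fun h => not_separated_lo_mid (w, true) h.symm)

theorem oriented_pair_iff_hasGap_true (hR : trapezoidGraph R = trapezoidGraph P.rep) (w : W) :
    Oriented R (w, false) (w, true) ↔ HasGap R (w, true) :=
  (oriented_iff_mid_hi hR (before_pair w)).trans
    (leftOf_congr_left hR (before_pair w).separated_mid_hi (separated_lo_hi (w, true))
      (not_separated_mid_hi (w, false)))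

theorem hasGap_iff (hR : trapezoidGraph R = trapezoidGraph P.rep) (g : W × Bool) :
    HasGap R g ↔ Oriented R (g.1, false) (g.1, true) := by
  obtain ⟨w, _ | _⟩ := g
  exacts [(oriented_pair_iff_hasGap_false hR w).symm, (oriented_pair_iff_hasGap_true hR w).symm]

theorem oriented_fst_iff_of_between (hR : trapezoidGraph R = trapezoidGraph P.rep)
    (h₁ : P.Before (w, false) h) (h₂ : P.Before h (w, true)) :
    Oriented R (w, false) h ↔ Oriented R (w, false) (w, true) := by
  rw [oriented_pair_iff_hasGap_false hR, oriented_iff_lo_mid hR h₁]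
  exact leftOf_congr_right hR h₁.separated_lo_mid (separated_lo_hi (w, false))
    (not_separated_mid_of_between h₁ h₂)

theorem oriented_snd_iff_of_between (hR : trapezoidGraph R = trapezoidGraph P.rep)
    (h₁ : P.Before (w, false) h) (h₂ : P.Before h (w, true)) :
    Oriented R h (w, true) ↔ Oriented R (w, false) (w, true) := by
  rw [oriented_pair_iff_hasGap_true hR, oriented_iff_mid_hi hR h₂]
  exact leftOf_congr_left hR h₂.separated_mid_hi (separated_lo_hi (w, true))
    (not_separated_mid_of_between h₁ h₂)

theorem oriented_fst_iff_snd_of_pair_before (hR : trapezoidGraph R = trapezoidGraph P.rep)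
    (h₁ : P.Before (w, false) h) (h₂ : P.Before (w, true) h) :
    Oriented R (w, false) h ↔ Oriented R (w, true) h := by
  rw [oriented_iff_lo_mid hR h₂]
  exact leftOf_congr_left hR h₁.separated_mid_mid h₂.separated_lo_mid
    (not_separated_mid_hi (w, false))

theorem oriented_fst_iff_snd_of_before_pair (hR : trapezoidGraph R = trapezoidGraph P.rep)
    (h₁ : P.Before h (w, false)) (h₂ : P.Before h (w, true)) :
    Oriented R h (w, false) ↔ Oriented R h (w, true) := by
  rw [oriented_iff_mid_hi hR h₁]
  exact leftOf_congr_right hR h₁.separated_mid_hi h₂.separated_mid_mid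
    (not_separated_lo_mid (w, true))

theorem oriented_rotate_iff (hR : trapezoidGraph R = trapezoidGraph P.rep)
    (hgh : P.Before g h) : Oriented (fun x => (R x).rotate) g h ↔ ¬ Oriented R g h := by
  have hsep : (R (mid g)).Separated (R (mid h)) :=
    (trapezoidGraph_eq_iff.1 hR _ _).2 hgh.separated_mid_mid
  rw [Oriented, Trapezoid.leftOf_rotate_iff]
  exact ⟨fun hhg hgh => (hgh.trans hhg).1.not_ge (R (mid g)).top_le, hsep.resolve_left⟩

/-! ### Slopes of crossing lines -/

variable (R) in
/-- In the representation `R` the gap at the line `g` is to the left of the gap at the line `h` on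
`L₁`, and to its right on `L₂`. -/
structure TopBefore (g h : W × Bool) : Prop where
  top_le : (R (hi g)).left.top ≤ (R (lo h)).right.top
  bot_le : (R (hi h)).left.bot ≤ (R (lo g)).right.bot

theorem Crosses.topBefore_or (hR : trapezoidGraph R = trapezoidGraph P.rep)
    (hgh : P.Crosses g h) (hg : HasGap R g) (hh : HasGap R h) :
    TopBefore R g h ∨ TopBefore R h g :=
  have hgap := Seg.cross_of_not_leftOf hg hh
    (fun hlt => not_separated_of_crosses hR hgh (meets_lo g) (meets_hi h) (Or.inl hlt))
    (fun hlt => not_separated_of_crosses hR hgh.symm (meets_lo h) (meets_hi g) (Or.inl hlt))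
  hgap.imp (fun hc => ⟨hc.1, hc.2⟩) fun hc => ⟨hc.1, hc.2⟩

/-- The parallelogram of a pair has a side on the border of the gap at each of its two lines. -/
theorem slope_eq_lo_or_hi (hpar : ∀ x, (R x).IsParallelogram) (g : W × Bool) :
    (R (g.1, 0)).left.slope = (R (lo g)).right.slope ∨
      (R (g.1, 0)).left.slope = (R (hi g)).left.slope := by
  obtain ⟨w, _ | _⟩ := g
  exacts [Or.inr rfl, Or.inl (hpar (w, 0))]

theorem TopBefore.slope_lt (hpar : ∀ x, (R x).IsParallelogram) (hgh : TopBefore R g h)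
    (hg : HasGap R g) (hh : HasGap R h) : (R (g.1, 0)).left.slope < (R (h.1, 0)).left.slope := by
  obtain ⟨htop, hbot⟩ := hgh
  obtain ⟨hg_top, hg_bot⟩ := hg
  obtain ⟨hh_top, hh_bot⟩ := hh
  rcases slope_eq_lo_or_hi hpar g with hsg | hsg <;>
    rcases slope_eq_lo_or_hi hpar h with hsh | hsh <;>
    rw [hsg, hsh, Seg.slope, Seg.slope] <;> linarith

end PairedLines

namespace Monotone3CNF.LiteralOrder

open PairedLines

variable {k n : ℕ} {φ : Monotone3CNF k n} {σ : LiteralOrder φ} {g h : σ.LinePair × Bool}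
  {x y z : Fin k × Fin 3} {i : Fin k} {j j' : Fin 3}

/-! ### The orientation of clauses and links -/

/-- `g` is one of the two lines of the literal `x`. -/
def OnLiteral (g : σ.LinePair × Bool) (x : Fin k × Fin 3) : Prop :=
  g = σ.fstLine x ∨ g = σ.sndLine x

theorem onLiteral_fst (x : Fin k × Fin 3) : OnLiteral (σ.fstLine x) x := Or.inl rfl

theorem onLiteral_snd (x : Fin k × Fin 3) : OnLiteral (σ.sndLine x) x := Or.inr rfl

theorem OnLiteral.places_fst (hg : OnLiteral g x) :
    (σ.topPlace g).1 = x ∧ (σ.botPlace g).1 = x := by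
  rcases hg with rfl | rfl
  · rw [(σ.places_fstLine x).1, (σ.places_fstLine x).2]
    exact ⟨rfl, rfl⟩
  · rw [(σ.places_sndLine x).1, (σ.places_sndLine x).2]
    exact ⟨rfl, rfl⟩

theorem before_of_places (htop : σ.pos (σ.topPlace g).1 < σ.pos (σ.topPlace h).1)
    (hbot : σ.pos (σ.botPlace g).1 < σ.pos (σ.botPlace h).1) : σ.lines.Before g h :=
  ⟨σ.place_lt_of_pos_lt htop _ _, σ.place_lt_of_pos_lt hbot _ _⟩

theorem OnLiteral.before (hg : OnLiteral g x) (hh : OnLiteral h y) (hxy : σ.pos x < σ.pos y) :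
    σ.lines.Before g h :=
  before_of_places (by rwa [hg.places_fst.1, hh.places_fst.1])
    (by rwa [hg.places_fst.2, hh.places_fst.2])

theorem OnLiteral.before_link (hg : OnLiteral g x) {q : σ.Link} (hx : σ.pos x < σ.pos q.1.1)
    (b : Bool) : σ.lines.Before g (.uv q, b) :=
  before_of_places
    (by rw [hg.places_fst.1]; cases b <;> exact hx.trans (σ.link_pos_lt q))
    (by rw [hg.places_fst.2]; cases b <;> exact hx)

theorem OnLiteral.link_before (hg : OnLiteral g x) {q : σ.Link} (hx : σ.pos q.1.2 < σ.pos x)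
    (b : Bool) : σ.lines.Before (.uv q, b) g :=
  before_of_places
    (by rw [hg.places_fst.1]; cases b <;> exact hx)
    (by rw [hg.places_fst.2]; cases b <;> exact (σ.link_pos_lt q).trans hx)

theorem crosses_fst_snd (x : Fin k × Fin 3) : σ.lines.Crosses (σ.fstLine x) (σ.sndLine x) := by
  simp only [Crosses, lines, σ.places_fstLine, σ.places_sndLine]
  exact Or.inl ⟨σ.place_lt_place_iff.2 (Or.inr ⟨rfl, by decide⟩),
    σ.place_lt_place_iff.2 (Or.inr ⟨rfl, by decide⟩)⟩

theorem crosses_fst_link (q : σ.Link) (b : Bool) :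
    σ.lines.Crosses (σ.fstLine q.1.1) (.uv q, b) := by
  simp only [Crosses, lines, σ.places_fstLine]
  refine Or.inl ⟨?_, ?_⟩ <;> cases b <;> refine σ.place_lt_place_iff.2 ?_
  exacts [Or.inl (σ.link_pos_lt q), Or.inl (σ.link_pos_lt q), Or.inr ⟨rfl, by decide⟩,
    Or.inr ⟨rfl, by decide⟩]

theorem crosses_link_fst (q : σ.Link) (b : Bool) :
    σ.lines.Crosses (.uv q, b) (σ.fstLine q.1.2) := by
  simp only [Crosses, lines, σ.places_fstLine]
  refine Or.inr ⟨?_, ?_⟩ <;> cases b <;> refine σ.place_lt_place_iff.2 ?_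
  exacts [Or.inr ⟨rfl, by decide⟩, Or.inr ⟨rfl, by decide⟩, Or.inl (σ.link_pos_lt q),
    Or.inl (σ.link_pos_lt q)]

theorem before_snd_link (q : σ.Link) (b : Bool) :
    σ.lines.Before (σ.sndLine q.1.1) (.uv q, b) := by
  simp only [Before, lines, σ.places_sndLine]
  constructor <;> cases b <;> refine σ.place_lt_place_iff.2 ?_
  exacts [Or.inl (σ.link_pos_lt q), Or.inl (σ.link_pos_lt q), Or.inr ⟨rfl, by decide⟩,
    Or.inr ⟨rfl, by decide⟩]

theorem before_link_snd (q : σ.Link) (b : Bool) :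
    σ.lines.Before (.uv q, b) (σ.sndLine q.1.2) := by
  simp only [Before, lines, σ.places_sndLine]
  constructor <;> cases b <;> refine σ.place_lt_place_iff.2 ?_
  exacts [Or.inr ⟨rfl, by decide⟩, Or.inr ⟨rfl, by decide⟩, Or.inl (σ.link_pos_lt q),
    Or.inl (σ.link_pos_lt q)]

theorem exists_pair_of_lt (i : Fin k) (hj : j < j') :
    ∃ w : σ.LinePair, OnLiteral (w, false) (i, j) ∧ OnLiteral (w, true) (i, j') := by
  obtain ⟨rfl, rfl⟩ | ⟨rfl, rfl⟩ | ⟨rfl, rfl⟩ :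
      j = 0 ∧ j' = 1 ∨ j = 0 ∧ j' = 2 ∨ j = 1 ∧ j' = 2 := by omega
  exacts [⟨.ab i, Or.inl rfl, Or.inr rfl⟩, ⟨.cd i, Or.inr rfl, Or.inl rfl⟩,
    ⟨.ef i, Or.inl rfl, Or.inr rfl⟩]

theorem OnLiteral.exists_pair (hg : OnLiteral g x) :
    ∃ j j', j < j' ∧ OnLiteral (g.1, false) (x.1, j) ∧ OnLiteral (g.1, true) (x.1, j') := by
  obtain ⟨i, j⟩ := x
  have hab : OnLiteral (σ := σ) (.ab i, false) (i, 0) ∧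
      OnLiteral (σ := σ) (.ab i, true) (i, 1) := ⟨Or.inl rfl, Or.inr rfl⟩
  have hcd : OnLiteral (σ := σ) (.cd i, false) (i, 0) ∧
      OnLiteral (σ := σ) (.cd i, true) (i, 2) := ⟨Or.inr rfl, Or.inl rfl⟩
  have hef : OnLiteral (σ := σ) (.ef i, false) (i, 1) ∧
      OnLiteral (σ := σ) (.ef i, true) (i, 2) := ⟨Or.inl rfl, Or.inr rfl⟩
  fin_cases j <;> rcases hg with rfl | rfl
  exacts [⟨0, 1, by decide, hab⟩, ⟨0, 2, by decide, hcd⟩, ⟨1, 2, by decide, hef⟩,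
    ⟨0, 1, by decide, hab⟩, ⟨0, 2, by decide, hcd⟩, ⟨1, 2, by decide, hef⟩]

variable {R : σ.LinePair × Fin 7 → Trapezoid}

variable (R) in
/-- In the representation `R` the literal `x` lies to the left of the literal `y`. -/
def LitOriented (x y : Fin k × Fin 3) : Prop := Oriented R (σ.fstLine x) (σ.fstLine y)

variable (R) in
/-- In the representation `R` the literals of the clause `i` are in their given order. -/
def ClauseOriented (i : Fin k) : Prop := LitOriented R (i, 0) (i, 2)

theorem OnLiteral.oriented_iff (hR : trapezoidGraph R = trapezoidGraph σ.lines.rep)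
    (hg : OnLiteral g x) (hh : OnLiteral h y) (hxy : σ.pos x < σ.pos y) :
    Oriented R g h ↔ LitOriented R x y := by
  trans Oriented R (σ.fstLine x) h
  · rcases hg with rfl | rfl
    · rfl
    · exact (crosses_fst_snd x).symm.oriented_congr_left hR ((onLiteral_snd x).before hh hxy)
        ((onLiteral_fst x).before hh hxy)
  · rcases hh with rfl | rfl
    · rfl
    · exact (crosses_fst_snd y).symm.oriented_congr_right hR
        ((onLiteral_fst x).before (onLiteral_snd y) hxy)
        ((onLiteral_fst x).before (onLiteral_fst y) hxy)

theorem litOriented_fst_iff_of_between (hR : trapezoidGraph R = trapezoidGraph σ.lines.rep)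
    (hj : j < j') (h₁ : σ.pos (i, j) < σ.pos z) (h₂ : σ.pos z < σ.pos (i, j')) :
    LitOriented R (i, j) z ↔ LitOriented R (i, j) (i, j') := by
  obtain ⟨w, hw, hw'⟩ := exists_pair_of_lt (σ := σ) i hj
  rw [← hw.oriented_iff hR (onLiteral_fst z) h₁, ← hw.oriented_iff hR hw' (h₁.trans h₂)]
  exact oriented_fst_iff_of_between hR (hw.before (onLiteral_fst z) h₁)
    ((onLiteral_fst z).before hw' h₂)

theorem litOriented_snd_iff_of_between (hR : trapezoidGraph R = trapezoidGraph σ.lines.rep)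
    (hj : j < j') (h₁ : σ.pos (i, j) < σ.pos z) (h₂ : σ.pos z < σ.pos (i, j')) :
    LitOriented R z (i, j') ↔ LitOriented R (i, j) (i, j') := by
  obtain ⟨w, hw, hw'⟩ := exists_pair_of_lt (σ := σ) i hj
  rw [← (onLiteral_fst z).oriented_iff hR hw' h₂, ← hw.oriented_iff hR hw' (h₁.trans h₂)]
  exact oriented_snd_iff_of_between hR (hw.before (onLiteral_fst z) h₁)
    ((onLiteral_fst z).before hw' h₂)

theorem litOriented_iff_of_clause_before (hR : trapezoidGraph R = trapezoidGraph σ.lines.rep)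
    (hj : j < j') (hz : σ.pos (i, j') < σ.pos z) :
    LitOriented R (i, j) z ↔ LitOriented R (i, j') z := by
  obtain ⟨w, hw, hw'⟩ := exists_pair_of_lt (σ := σ) i hj
  have hz' : σ.pos (i, j) < σ.pos z := (σ.pos_lt_pos i hj).trans hz
  rw [← hw.oriented_iff hR (onLiteral_fst z) hz', ← hw'.oriented_iff hR (onLiteral_fst z) hz]
  exact oriented_fst_iff_snd_of_pair_before hR (hw.before (onLiteral_fst z) hz')
    (hw'.before (onLiteral_fst z) hz)

theorem litOriented_iff_of_before_clause (hR : trapezoidGraph R = trapezoidGraph σ.lines.rep)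
    (hj : j < j') (hz : σ.pos z < σ.pos (i, j)) :
    LitOriented R z (i, j) ↔ LitOriented R z (i, j') := by
  obtain ⟨w, hw, hw'⟩ := exists_pair_of_lt (σ := σ) i hj
  have hz' : σ.pos z < σ.pos (i, j') := hz.trans (σ.pos_lt_pos i hj)
  rw [← (onLiteral_fst z).oriented_iff hR hw hz, ← (onLiteral_fst z).oriented_iff hR hw' hz']
  exact oriented_fst_iff_snd_of_before_pair hR ((onLiteral_fst z).before hw hz)
    ((onLiteral_fst z).before hw' hz')

theorem litOriented_iff_of_link_before (hR : trapezoidGraph R = trapezoidGraph σ.lines.rep)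
    (q : σ.Link) (hz : σ.pos q.1.2 < σ.pos z) :
    LitOriented R q.1.1 z ↔ LitOriented R q.1.2 z := by
  have hu : σ.lines.Before (.uv q, false) (σ.fstLine z) := (onLiteral_fst z).link_before hz false
  have hz' : σ.pos q.1.1 < σ.pos z := (σ.link_pos_lt q).trans hz
  exact ((crosses_fst_link q false).oriented_congr_left hR
    ((onLiteral_fst _).before (onLiteral_fst z) hz') hu).trans
    ((crosses_link_fst q false).oriented_congr_left hR hu
      ((onLiteral_fst _).before (onLiteral_fst z) hz))

theorem litOriented_iff_of_before_link (hR : trapezoidGraph R = trapezoidGraph σ.lines.rep)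
    (q : σ.Link) (hz : σ.pos z < σ.pos q.1.1) :
    LitOriented R z q.1.1 ↔ LitOriented R z q.1.2 := by
  have hu : σ.lines.Before (σ.fstLine z) (.uv q, false) := (onLiteral_fst z).before_link hz false
  have hz' : σ.pos z < σ.pos q.1.2 := hz.trans (σ.link_pos_lt q)
  exact ((crosses_fst_link q false).oriented_congr_right hR
    ((onLiteral_fst z).before (onLiteral_fst _) hz) hu).trans
    ((crosses_link_fst q false).oriented_congr_right hR hu
      ((onLiteral_fst z).before (onLiteral_fst _) hz'))

theorem litOriented_clause_iff (hR : trapezoidGraph R = trapezoidGraph σ.lines.rep) (hj : j < j') :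
    LitOriented R (i, j) (i, j') ↔ ClauseOriented R i := by
  have h₀₁ : σ.pos (i, 0) < σ.pos (i, 1) := σ.pos_lt_pos i (by decide)
  have h₁₂ : σ.pos (i, 1) < σ.pos (i, 2) := σ.pos_lt_pos i (by decide)
  obtain ⟨rfl, rfl⟩ | ⟨rfl, rfl⟩ | ⟨rfl, rfl⟩ :
      j = 0 ∧ j' = 1 ∨ j = 0 ∧ j' = 2 ∨ j = 1 ∧ j' = 2 := by omega
  exacts [litOriented_fst_iff_of_between hR (by decide) h₀₁ h₁₂, Iff.rfl,
    litOriented_snd_iff_of_between hR (by decide) h₀₁ h₁₂]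

theorem OnLiteral.hasGap_iff (hR : trapezoidGraph R = trapezoidGraph σ.lines.rep)
    (hg : OnLiteral g x) : HasGap R g ↔ ClauseOriented R x.1 := by
  obtain ⟨j, j', hj, hfst, hsnd⟩ := hg.exists_pair
  rw [PairedLines.hasGap_iff hR, hfst.oriented_iff hR hsnd (σ.pos_lt_pos x.1 hj),
    litOriented_clause_iff hR hj]

theorem litOriented_link_iff_fst (hR : trapezoidGraph R = trapezoidGraph σ.lines.rep)
    (q : σ.Link) : LitOriented R q.1.1 q.1.2 ↔ ClauseOriented R q.1.1.1 := by
  have hlt := σ.link_pos_lt q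
  obtain ⟨⟨⟨i, j⟩, y⟩, hpos, hvar⟩ := q
  rcases (Fin.le_last j).eq_or_lt with rfl | hj
  · have h₀₂ : σ.pos (i, 0) < σ.pos (i, 2) := σ.pos_lt_pos i (by decide)
    exact (litOriented_iff_of_clause_before hR (by decide) hlt).symm.trans
      (litOriented_iff_of_before_link hR ⟨((i, 2), y), hpos, hvar⟩ h₀₂).symm
  · have hy : σ.pos y < σ.pos (i, 2) := σ.lt_of_var_lt _ _ (hvar ▸ φ.strictMono i hj)
    exact (litOriented_fst_iff_of_between hR hj hlt hy).trans (litOriented_clause_iff hR hj)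

theorem litOriented_link_iff_snd (hR : trapezoidGraph R = trapezoidGraph σ.lines.rep)
    (q : σ.Link) : LitOriented R q.1.1 q.1.2 ↔ ClauseOriented R q.1.2.1 := by
  have hlt := σ.link_pos_lt q
  obtain ⟨⟨x, ⟨i, j⟩⟩, hpos, hvar⟩ := q
  rcases (Fin.zero_le j).eq_or_lt with rfl | hj
  · have h₀₂ : σ.pos (i, 0) < σ.pos (i, 2) := σ.pos_lt_pos i (by decide)
    exact (litOriented_iff_of_before_clause hR (by decide) hlt).trans
      (litOriented_iff_of_link_before hR ⟨(x, (i, 0)), hpos, hvar⟩ h₀₂)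
  · have hx : σ.pos (i, 0) < σ.pos x := σ.lt_of_var_lt _ _ (hvar ▸ φ.strictMono i hj)
    exact (litOriented_snd_iff_of_between hR hj hx hlt).trans (litOriented_clause_iff hR hj)

theorem clauseOriented_link_iff (hR : trapezoidGraph R = trapezoidGraph σ.lines.rep)
    (q : σ.Link) : ClauseOriented R q.1.1.1 ↔ ClauseOriented R q.1.2.1 :=
  (litOriented_link_iff_fst hR q).symm.trans (litOriented_link_iff_snd hR q)

theorem oriented_snd_link_iff (hR : trapezoidGraph R = trapezoidGraph σ.lines.rep) (q : σ.Link)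
    (b : Bool) : Oriented R (σ.sndLine q.1.1) (.uv q, b) ↔ ClauseOriented R q.1.1.1 := by
  have hlt := σ.link_pos_lt q
  rw [← litOriented_link_iff_fst hR,
    ← (onLiteral_snd q.1.1).oriented_iff hR (onLiteral_fst q.1.2) hlt]
  exact (crosses_link_fst q b).oriented_congr_right hR (before_snd_link q b)
    ((onLiteral_snd _).before (onLiteral_fst _) hlt)

theorem oriented_link_snd_iff (hR : trapezoidGraph R = trapezoidGraph σ.lines.rep) (q : σ.Link)
    (b : Bool) : Oriented R (.uv q, b) (σ.sndLine q.1.2) ↔ ClauseOriented R q.1.1.1 := by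
  have hlt := σ.link_pos_lt q
  rw [← litOriented_link_iff_fst hR,
    ← (onLiteral_fst q.1.1).oriented_iff hR (onLiteral_snd q.1.2) hlt]
  exact (crosses_fst_link q b).symm.oriented_congr_left hR (before_link_snd q b)
    ((onLiteral_fst _).before (onLiteral_snd _) hlt)

/-! ### The truth assignment given by the slopes -/

theorem clauseOriented_rotate_iff (hR : trapezoidGraph R = trapezoidGraph σ.lines.rep) :
    ClauseOriented (fun v => (R v).rotate) i ↔ ¬ ClauseOriented R i :=
  oriented_rotate_iff hR
    ((onLiteral_fst _).before (onLiteral_fst _) (σ.pos_lt_pos i (by decide)))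

theorem clauseOriented_flip_iff :
    ClauseOriented (fun v => (R v).flip) i ↔ ClauseOriented R i := Trapezoid.leftOf_flip_iff

variable (R) in
/-- The slope, in the representation `R`, of the trapezoid of a pair. -/
def pairSlope (w : σ.LinePair) : ℝ := (R (w, 0)).left.slope

variable (R) in
/-- The literal `x` is true: its pairs have increasing slopes in the representation `R`. -/
def IsTrueAt (x : Fin k × Fin 3) : Prop :=
  pairSlope R (σ.fstLine x).1 < pairSlope R (σ.sndLine x).1

theorem pairSlope_rotate (hpar : ∀ v, (R v).IsParallelogram) (w : σ.LinePair) :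
    pairSlope (fun v => (R v).rotate) w = pairSlope R w := (hpar (w, 0)).slope_left_rotate

theorem pairSlope_flip (w : σ.LinePair) :
    pairSlope (fun v => (R v).flip) w = -pairSlope R w := (R (w, 0)).slope_left_flip

theorem isTrueAt_rotate_iff (hpar : ∀ v, (R v).IsParallelogram) :
    IsTrueAt (fun v => (R v).rotate) x ↔ IsTrueAt R x := by
  rw [IsTrueAt, pairSlope_rotate hpar, pairSlope_rotate hpar, IsTrueAt]

theorem pairSlope_ne_of_clauseOriented (hR : trapezoidGraph R = trapezoidGraph σ.lines.rep)
    (hpar : ∀ v, (R v).IsParallelogram) (hx : ClauseOriented R x.1) :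
    pairSlope R (σ.fstLine x).1 ≠ pairSlope R (σ.sndLine x).1 := by
  have hfst := ((onLiteral_fst x).hasGap_iff hR).2 hx
  have hsnd := ((onLiteral_snd x).hasGap_iff hR).2 hx
  rcases (crosses_fst_snd x).topBefore_or hR hfst hsnd with h | h
  exacts [(h.slope_lt hpar hfst hsnd).ne, (h.slope_lt hpar hsnd hfst).ne']

theorem pairSlope_fst_ne_snd (hR : trapezoidGraph R = trapezoidGraph σ.lines.rep)
    (hpar : ∀ v, (R v).IsParallelogram) (x : Fin k × Fin 3) :
    pairSlope R (σ.fstLine x).1 ≠ pairSlope R (σ.sndLine x).1 := by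
  by_cases hx : ClauseOriented R x.1
  · exact pairSlope_ne_of_clauseOriented hR hpar hx
  · have hne := pairSlope_ne_of_clauseOriented ((Trapezoid.trapezoidGraph_rotate R).trans hR)
      (fun v => (hpar v).rotate) ((clauseOriented_rotate_iff hR).2 hx)
    rwa [pairSlope_rotate hpar, pairSlope_rotate hpar] at hne

theorem isTrueAt_flip_iff (hR : trapezoidGraph R = trapezoidGraph σ.lines.rep)
    (hpar : ∀ v, (R v).IsParallelogram) :
    IsTrueAt (fun v => (R v).flip) x ↔ ¬ IsTrueAt R x := by
  rw [IsTrueAt, pairSlope_flip, pairSlope_flip, neg_lt_neg_iff, IsTrueAt, not_lt,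
    (pairSlope_fst_ne_snd hR hpar x).symm.le_iff_lt]

theorem ClauseOriented.link_bot_le (hR : trapezoidGraph R = trapezoidGraph σ.lines.rep)
    {q : σ.Link} (hq : ClauseOriented R q.1.1.1)
    (hx : TopBefore R (σ.fstLine q.1.1) (σ.sndLine q.1.1)) (b : Bool) :
    (R (mid (.uv q, b))).left.bot ≤ (R (lo (σ.fstLine q.1.1))).right.bot := by
  have hgap : HasGap R (σ.fstLine q.1.1) := ((onLiteral_fst _).hasGap_iff hR).2 hq
  have hsnd : (R (lo (σ.sndLine q.1.1))).LeftOf (R (mid (.uv q, b))) :=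
    (oriented_iff_lo_mid hR (before_snd_link q b)).1 ((oriented_snd_link_iff hR q b).2 hq)
  have hcross : ¬ (R (lo (σ.fstLine q.1.1))).LeftOf (R (mid (.uv q, b))) := fun h =>
    not_separated_of_crosses hR (crosses_fst_link q b) (meets_lo _) (meets_mid _) (Or.inl h)
  exact not_lt.1 fun hlt => hcross ⟨hgap.1.trans_le (hx.top_le.trans hsnd.1.le), hlt⟩

theorem ClauseOriented.le_link_bot (hR : trapezoidGraph R = trapezoidGraph σ.lines.rep)
    {q : σ.Link} (hq : ClauseOriented R q.1.1.1)
    (hy : TopBefore R (σ.sndLine q.1.2) (σ.fstLine q.1.2)) (b : Bool) :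
    (R (hi (σ.fstLine q.1.2))).left.bot ≤ (R (mid (.uv q, b))).right.bot := by
  have hgap : HasGap R (σ.fstLine q.1.2) :=
    ((onLiteral_fst _).hasGap_iff hR).2 ((clauseOriented_link_iff hR q).1 hq)
  have hsnd : (R (mid (.uv q, b))).LeftOf (R (hi (σ.sndLine q.1.2))) :=
    (oriented_iff_mid_hi hR (before_link_snd q b)).1 ((oriented_link_snd_iff hR q b).2 hq)
  have hcross : ¬ (R (mid (.uv q, b))).LeftOf (R (hi (σ.fstLine q.1.2))) := fun h =>
    not_separated_of_crosses hR (crosses_link_fst q b) (meets_mid _) (meets_hi _) (Or.inl h)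
  exact not_lt.1 fun hlt => hcross ⟨(hsnd.1.trans_le hy.top_le).trans hgap.1, hlt⟩

/-- If the truth values at the ends of a link differed, both of its parallelograms would contain
the part of `L₂` between the gaps of the two lines `ℓ¹`, and so meet. -/
theorem ClauseOriented.not_topBefore_of_link (hR : trapezoidGraph R = trapezoidGraph σ.lines.rep)
    {q : σ.Link} (hq : ClauseOriented R q.1.1.1)
    (hx : TopBefore R (σ.fstLine q.1.1) (σ.sndLine q.1.1)) :
    ¬ TopBefore R (σ.sndLine q.1.2) (σ.fstLine q.1.2) := by
  intro hy
  have hfst : (R (lo (σ.fstLine q.1.1))).LeftOf (R (hi (σ.fstLine q.1.2))) :=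
    (oriented_iff_lo_hi hR ((onLiteral_fst _).before (onLiteral_fst _) (σ.link_pos_lt q))).1
      ((litOriented_link_iff_fst hR q).2 hq)
  have hle (b b' : Bool) : (R (mid (.uv q, b))).left.bot ≤ (R (mid (.uv q, b'))).right.bot :=
    (hq.link_bot_le hR hx b).trans (hfst.2.le.trans (hq.le_link_bot hR hy b'))
  rcases (trapezoidGraph_eq_iff.1 hR _ _).2 (before_pair (.uv q)).separated_mid_mid with h | h
  exacts [(hle true false).not_gt h.2, (hle false true).not_gt h.2]

theorem IsTrueAt.of_link (hR : trapezoidGraph R = trapezoidGraph σ.lines.rep)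
    (hpar : ∀ v, (R v).IsParallelogram) {q : σ.Link} (hq : ClauseOriented R q.1.1.1)
    (hx : IsTrueAt R q.1.1) : IsTrueAt R q.1.2 := by
  have hq' := (clauseOriented_link_iff hR q).1 hq
  have hx₁ := ((onLiteral_fst q.1.1).hasGap_iff hR).2 hq
  have hx₂ := ((onLiteral_snd q.1.1).hasGap_iff hR).2 hq
  have hy₁ := ((onLiteral_fst q.1.2).hasGap_iff hR).2 hq'
  have hy₂ := ((onLiteral_snd q.1.2).hasGap_iff hR).2 hq'
  have hx_top : TopBefore R (σ.fstLine q.1.1) (σ.sndLine q.1.1) :=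
    ((crosses_fst_snd q.1.1).topBefore_or hR hx₁ hx₂).resolve_right fun h =>
      (h.slope_lt hpar hx₂ hx₁).not_gt hx
  have hy_top : TopBefore R (σ.fstLine q.1.2) (σ.sndLine q.1.2) :=
    ((crosses_fst_snd q.1.2).topBefore_or hR hy₁ hy₂).resolve_right
      (hq.not_topBefore_of_link hR hx_top)
  exact hy_top.slope_lt hpar hy₁ hy₂

theorem ClauseOriented.isTrueAt_link_iff (hR : trapezoidGraph R = trapezoidGraph σ.lines.rep)
    (hpar : ∀ v, (R v).IsParallelogram) {q : σ.Link} (hq : ClauseOriented R q.1.1.1) :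
    IsTrueAt R q.1.1 ↔ IsTrueAt R q.1.2 := by
  refine ⟨IsTrueAt.of_link hR hpar hq, fun hy => ?_⟩
  by_contra hx
  have hy' := IsTrueAt.of_link ((Trapezoid.trapezoidGraph_flip R).trans hR)
    (fun v => (hpar v).flip) (clauseOriented_flip_iff.2 hq) ((isTrueAt_flip_iff hR hpar).2 hx)
  exact (isTrueAt_flip_iff hR hpar).1 hy' hy

theorem isTrueAt_link_iff (hR : trapezoidGraph R = trapezoidGraph σ.lines.rep)
    (hpar : ∀ v, (R v).IsParallelogram) (q : σ.Link) :
    IsTrueAt R q.1.1 ↔ IsTrueAt R q.1.2 := by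
  by_cases hq : ClauseOriented R q.1.1.1
  · exact hq.isTrueAt_link_iff hR hpar
  · rw [← isTrueAt_rotate_iff hpar, ← isTrueAt_rotate_iff hpar]
    exact ClauseOriented.isTrueAt_link_iff ((Trapezoid.trapezoidGraph_rotate R).trans hR)
      (fun v => (hpar v).rotate) ((clauseOriented_rotate_iff hR).2 hq)

theorem isTrueAt_iff_of_pos_le (hR : trapezoidGraph R = trapezoidGraph σ.lines.rep)
    (hpar : ∀ v, (R v).IsParallelogram) (hle : σ.pos x ≤ σ.pos y)
    (hv : φ.var x.1 x.2 = φ.var y.1 y.2) : IsTrueAt R x ↔ IsTrueAt R y := by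
  obtain ⟨d, hd⟩ := Nat.exists_eq_add_of_le (Fin.le_def.1 hle)
  clear hle
  induction d generalizing x with
  | zero => rw [σ.pos_inj.1 hd]
  | succ d ih =>
    obtain ⟨z, hz⟩ := σ.pos.surjective ⟨σ.pos x + 1, by have := (σ.pos y).2; omega⟩
    have hpos : (σ.pos z : ℕ) = σ.pos x + 1 := congrArg Fin.val hz
    have hxz : φ.var x.1 x.2 = φ.var z.1 z.2 :=
      le_antisymm (σ.var_le_of_pos_le (Fin.le_def.2 (by omega)))
        (hv ▸ σ.var_le_of_pos_le (Fin.le_def.2 (by omega)))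
    have hlink : IsTrueAt R x ↔ IsTrueAt R z := isTrueAt_link_iff hR hpar ⟨(x, z), hpos, hxz⟩
    have hyz : (σ.pos y : ℕ) = σ.pos z + d := by omega
    exact hlink.trans (ih (hxz ▸ hv) hyz)

theorem isTrueAt_iff_of_var_eq (hR : trapezoidGraph R = trapezoidGraph σ.lines.rep)
    (hpar : ∀ v, (R v).IsParallelogram) (hv : φ.var x.1 x.2 = φ.var y.1 y.2) :
    IsTrueAt R x ↔ IsTrueAt R y := by
  rcases le_total (σ.pos x) (σ.pos y) with hle | hle
  exacts [isTrueAt_iff_of_pos_le hR hpar hle hv, (isTrueAt_iff_of_pos_le hR hpar hle hv.symm).symm]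

theorem naeSatisfiable_of_isBoundedToleranceGraph (σ : LiteralOrder φ)
    (hG : IsBoundedToleranceGraph σ.graphH) : φ.NAESatisfiable := by
  classical
  obtain ⟨R, hpar, hR⟩ := hG.exists_isParallelogram
  replace hR : trapezoidGraph R = trapezoidGraph σ.lines.rep :=
    hR.symm.trans (congrArg trapezoidGraph σ.repH_eq)
  let τ : Fin n → Bool := fun p => decide (∃ x, φ.var x.1 x.2 = p ∧ IsTrueAt R x)
  have hτ : OrdersPairs (pairSlope R) τ := fun x => by
    refine ⟨pairSlope_fst_ne_snd hR hpar x, fun hx => decide_eq_true ⟨x, rfl, hx⟩, fun hx => ?_⟩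
    obtain ⟨y, hv, hy⟩ := of_decide_eq_true hx
    exact (isTrueAt_iff_of_var_eq hR hpar hv).1 hy
  exact ⟨τ, hτ.nae⟩

end Monotone3CNF.LiteralOrder

theorem theorem3p2 {k n : ℕ} (φ : Monotone3CNF k n) (σ : φ.LiteralOrder) :
    IsTrapezoidGraph σ.graphH ∧
    Nat.card (σ.LinePair × Fin 7) =
      7 * (6 * k - (Set.range fun x : Fin k × Fin 3 => φ.var x.1 x.2).ncard) ∧
    (φ.NAESatisfiable ↔ IsBoundedToleranceGraph σ.graphH) :=
  ⟨⟨σ.repH, rfl⟩, σ.card_vertices, σ.isBoundedToleranceGraph_of_naeSatisfiable,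
    σ.naeSatisfiable_of_isBoundedToleranceGraph⟩
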